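/- **Environment.** A finite random set $C\subset\mathbb N$ of potential coordinators is drawn from a distribution $\beta_C$ with $\Pr(|C|\le 1)=0$. Every potential coordinator $c$ has $\kappa$ potential agents $(c,1),\dots,(c,\kappa)$; the set $A_c$ of those who are actually present is drawn from a distribution $\beta_A$ on the subsets of $\{1,\dots,\kappa\}$ with $\Pr(A_c=\varnothing)=0$. Valuations have an atomless law on $[0,\infty)$ with distribution function $F$. The set $C$, the sets $A_c$ and all valuations are independent. The agents present are those of the coordinators in $C$. Each of them knows his valuation $v$ and the number $k=|A_c|$ of agents of his coordinator; this pair is his type. If $k\ge 2$, these agents are invited to form a bidding club; if $k=1$, the agent is a non-member. Let $\gamma_A$ be the law of $|A_c|$, and let $P^{n,k}=(p^{n,k}_m)_m$ be the law of $k+X_1+\dots+X_{n-1}$ with $X_1,X_2,\dots$ independent with law $\gamma_A$. **Equilibrium bids.** For $j\ge 2$ let $b^e(v,j)=v-F(v)^{-(j-1)}\int_0^vF(u)^{j-1}\,du$, and for a distribution $P=(p_j)$ of the number of bidders let $$b^e(v,P)=\sum_{j\ge2}\frac{p_jF(v)^{j-1}}{\sum_{l\ge2}p_lF(v)^{l-1}}\,b^e(v,j)\qquad(\text{and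 } b^e(v,P)=0\text{ if }F(v)=0).$$ **Game.** An invited agent either accepts, and reports a valuation $\mu_i\in\mathbb R$ to his coordinator, or declines. Non-members and decliners either register in the main auction or stay out. The auctioneer announces the number $n$ of registered bidders, then bids are placed, and those who registered on their own may let their bid depend on $n$. The highest bidder gets the good and pays his bid (ties are broken uniformly at random). A coordinator with $k\ge2$ agents acts as follows. If at least one of them declines, he registers all agents $i$ who accepted and bids $b^e(\mu_i,P^{n,k})$ for each. If all accept, he registers only an agent $h$ with the highest report (the one of lowest index among equal reports) and bids $b^e(\mu_h,P^{n,1})$ for him; if $h$ wins, he pays in addition $b^e(\mu_h,P^{n,k})-b^e(\mu_h,P^{n,1})$ to the coordinator. The winner's utility is his valuation minus his payments, and that of all others is $0$. **Theorem.** For all $n\ge2$ and $k\ge1$, $b^e(\cdot,P^{n,k})$ is a symmetric equilibrium of the ordinary first-price auction in which the number of bidders is distributed according to $P^{n,k}$ and valuations are independent with distribution function $F$. Moreover, it is a Bayes–Nash equilibrium of the bidding-club game that every invited agent accepts the invitation and reports his valuation truthfully, and that every non-member registers and bids $b^e(v,P^{n,1})$, where $n$ is the announced number of bidders: for every agent and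 each of his types $(v,k)$, $v\ge0$, no other strategy gives a higher expected utility, conditional on his being present and on his type, when all others behave as described. -/

import Mathlib

open MeasureTheory ProbabilityTheory
open scoped ENNReal

noncomputable section

namespace BiddingClubs

/-! ### Equilibrium bids -/

/-- `b^e(v, j)`: the equilibrium bid of an agent with valuation `v` in the classical first-price
auction with `j` bidders whose valuations are independent with distribution function `F`. -/
def bidFixed (F : ℝ → ℝ) (v : ℝ) (j : ℕ) : ℝ :=
  v - (F v ^ (j - 1))⁻¹ * ∫ u in (0 : ℝ)..v, F u ^ (j - 1)

/-- `∑_{j ≥ 2} p_j F(v)^{j-1}`: the probability that all the other bidders have valuation at most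
`v`, when the number of bidders has distribution `P`. -/
def topProb (F : ℝ → ℝ) (v : ℝ) (P : PMF ℕ) : ℝ :=
  ∑' j : ℕ, if 2 ≤ j then (P j).toReal * F v ^ (j - 1) else 0

/-- `b^e(v, P)`: the equilibrium bid of an agent with valuation `v` in the first-price auction with
a stochastic number of bidders, distributed according to `P`. It is the mean of the bids
`b^e(v, j)`, `j ≥ 2`, with weights proportional to `p_j F(v)^{j-1}`. (It is `0` when
`F v = 0`.) -/
def bidStoch (F : ℝ → ℝ) (v : ℝ) (P : PMF ℕ) : ℝ :=
  ∑' j : ℕ, if 2 ≤ j then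
    (P j).toReal * F v ^ (j - 1) / topProb F v P * bidFixed F v j else 0

/-- Utility of a bidder with valuation `v` and bid `x` in a sealed-bid first-price auction in which
the other bids are `y`, ties being broken uniformly at random. -/
def firstPriceUtility (v x : ℝ) {m : ℕ} (y : Fin m → ℝ) : ℝ :=
  open Classical in
  if ∀ l, y l ≤ x then (v - x) / (1 + (Finset.univ.filter fun l => y l = x).card : ℕ) else 0

/-- Expected utility of an agent with valuation `v` who bids `x` in the first-price auction with a
stochastic number of bidders, distributed according to `P`, valuations being independent with law
`μ`, when every other agent bids `b` of his valuation. -/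
def stochUtility (μ : Measure ℝ) (P : PMF ℕ) (b : ℝ → ℝ) (v x : ℝ) : ℝ :=
  ∑' j : ℕ, if 2 ≤ j then
    (P j).toReal *
      ∫ w : Fin (j - 1) → ℝ, firstPriceUtility v x (fun l => b (w l)) ∂(Measure.pi fun _ => μ)
    else 0

/-- `b` is a symmetric equilibrium of the first-price auction with a stochastic number of
bidders. -/
def IsSymmetricEquilibrium (μ : Measure ℝ) (P : PMF ℕ) (b : ℝ → ℝ) : Prop :=
  ∀ v, 0 ≤ v → ∀ x, stochUtility μ P b v x ≤ stochUtility μ P b v (b v)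

/-! ### The economic environment -/

/-- The law of the sum of `m` independent numbers drawn from `γ`. -/
def iidSum (γ : PMF ℕ) : ℕ → PMF ℕ
  | 0 => PMF.pure 0
  | m + 1 => (iidSum γ m).bind fun s => γ.map fun t => s + t

/-- `P^{n,k}`: the law of the total number of agents when there are `n` potential coordinators, one
of which has exactly `k` agents, while the numbers of agents of the others are independently drawn
from `γ`. -/
def belief (γ : PMF ℕ) (n k : ℕ) : PMF ℕ :=
  (iidSum γ (n - 1)).map fun s => k + s

/-- A potential agent: the pair `(c, a)` is the `a`-th potential agent of the potential
coordinator `c`. Each coordinator has `κ` potential agents. -/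
abbrev Agent (κ : ℕ) : Type := ℕ × Fin κ

/-- A state of the world: the set of selected potential coordinators, the set of agents selected for
each potential coordinator, and the valuations. -/
abbrev State (κ : ℕ) : Type := Finset ℕ × (ℕ → Finset (Fin κ)) × (Agent κ → ℝ)

/-- The prior: the set of coordinators is drawn from `βC`, the sets of agents of the coordinators
are drawn from `βA` and the valuations from `μ`, everything independently. -/
def prior {κ : ℕ} (βC : PMF (Finset ℕ)) (βA : PMF (Finset (Fin κ))) (μ : Measure ℝ)
    [IsProbabilityMeasure μ] : Measure (State κ) :=
  βC.toMeasure.prod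
    ((Measure.infinitePi fun _ : ℕ => βA.toMeasure).prod
      (Measure.infinitePi fun _ : Agent κ => μ))

/-- The event that agent `i` is selected and that there are `k` agents in his club, himself
included. -/
def selected {κ : ℕ} (i : Agent κ) (k : ℕ) : Set (State κ) :=
  {ω | i.1 ∈ ω.1 ∧ i.2 ∈ ω.2.1 i.1 ∧ (ω.2.1 i.1).card = k}

/-! ### Actions and the augmented auction mechanism -/

/-- What an agent may do: stay out of everything; register in the main auction on his own and, when
the auctioneer has announced the number `n` of registered bidders, bid `bid n`; or accept the
invitation of his coordinator and report the valuation `report`. The first two are the ways of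
declining an invitation. -/
inductive Action : Type
  | abstain : Action
  | direct (bid : ℕ → ℝ) : Action
  | join (report : ℝ) : Action

/-- The agent accepts the invitation. -/
def Action.IsJoin : Action → Prop
  | .join _ => True
  | _ => False

/-- The reported valuation (relevant only for those who accept the invitation). -/
def Action.report : Action → ℝ
  | .join r => r
  | _ => 0

/-- A strategy maps the type of an agent, that is, his valuation and the number of agents in his
club, to an action. -/
abbrev Strategy : Type := ℝ → ℕ → Action

/-- There is a club to join only if it has at least two agents. -/
def Strategy.Feasible (s : Strategy) : Prop :=
  ∀ v k, (s v k).IsJoin → 2 ≤ k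

section Mechanism

variable {κ : ℕ} (F : ℝ → ℝ) (γ : PMF ℕ) (C : Finset ℕ) (A : ℕ → Finset (Fin κ))
  (act : Agent κ → Action)

/-- All agents of coordinator `c` accepted the invitation. -/
def AllJoin (c : ℕ) : Prop :=
  ∀ a ∈ A c, (act (c, a)).IsJoin

/-- Agent `i` has the highest report among the agents of his coordinator (among several agents with
the same highest report the one with the lowest index is taken). -/
def IsTop (i : Agent κ) : Prop :=
  ∀ a ∈ A i.1, (act (i.1, a)).report < (act i).report ∨
    ((act (i.1, a)).report = (act i).report ∧ i.2 ≤ a)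

/-- The agents who are registered in the main auction. If all agents of a club accepted the
invitation, then the coordinator drops all of them but the one with the highest report. Otherwise
the coordinator registers all those who accepted, and those who declined register or not, as they
choose. -/
def bidders : Finset (Agent κ) :=
  open Classical in
  (C ×ˢ (Finset.univ : Finset (Fin κ))).filter fun i =>
    i.2 ∈ A i.1 ∧ if AllJoin A act i.1 then IsTop A act i else act i ≠ Action.abstain

/-- The number of bidders that the auctioneer announces. -/
def announced : ℕ := (bidders C A act).card

/-- The bid placed in the main auction by, or on behalf of, the registered agent `i`. -/
def mainBid (i : Agent κ) : ℝ :=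
  open Classical in
  match act i with
  | .abstain => 0
  | .direct b => b (announced C A act)
  | .join r =>
      if AllJoin A act i.1 then bidStoch F r (belief γ (announced C A act) 1)
      else bidStoch F r (belief γ (announced C A act) (A i.1).card)

/-- The additional payment that agent `i` makes to his coordinator if he wins. -/
def clubPayment (i : Agent κ) : ℝ :=
  open Classical in
  match act i with
  | .join r =>
      if AllJoin A act i.1 then
        bidStoch F r (belief γ (announced C A act) (A i.1).card)
          - bidStoch F r (belief γ (announced C A act) 1)
      else 0
  | _ => 0

/-- The registered agents with the highest bid. -/
def winners : Finset (Agent κ) :=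
  open Classical in
  (bidders C A act).filter fun i =>
    ∀ j ∈ bidders C A act, mainBid F γ C A act j ≤ mainBid F γ C A act i

/-- The utility of agent `i` if his valuation is `v`. Ties in the main auction are broken uniformly
at random, and the utility is the expectation over this lottery. The winner pays his bid to the
auctioneer and the club payment to his coordinator. -/
def utility (v : ℝ) (i : Agent κ) : ℝ :=
  open Classical in
  if i ∈ winners F γ C A act then
    (v - mainBid F γ C A act i - clubPayment F γ C A act i) / (winners F γ C A act).card
  else 0

end Mechanism

/-! ### The Bayesian game -/

/-- The expectation of `u`, with values in `[-∞, ∞]`. -/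
def expectation {Ω : Type} [MeasurableSpace Ω] (P : Measure Ω) (u : Ω → ℝ) : EReal :=
  ((∫⁻ ω, ENNReal.ofReal (u ω) ∂P : ℝ≥0∞) : EReal)
    - ((∫⁻ ω, ENNReal.ofReal (-u ω) ∂P : ℝ≥0∞) : EReal)

/-- The expected utility of agent `i` of type `(v, k)` if he takes the action `d` and the other
agents follow the strategies `σ`. It is computed under the prior conditioned on the event that `i`
is selected and has `k` agents in his club; his own valuation is independent of the rest of the
state, and is fixed to be `v`. -/
def interimUtility {κ : ℕ} (βC : PMF (Finset ℕ)) (βA : PMF (Finset (Fin κ))) (μ : Measure ℝ)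
    [IsProbabilityMeasure μ] (σ : Agent κ → Strategy) (i : Agent κ) (v : ℝ) (k : ℕ)
    (d : Action) : EReal :=
  expectation ((prior βC βA μ)[|selected i k]) fun ω =>
    utility (cdf μ) (βA.map Finset.card) ω.1 ω.2.1
      (Function.update (fun j => σ j (ω.2.2 j) (ω.2.1 j.1).card) i d) v i

/-- `σ` is a Bayes–Nash equilibrium: all strategies are feasible and, for every agent and each of
his types, no feasible strategy gives him a higher expected utility. -/
def IsBayesNash {κ : ℕ} (βC : PMF (Finset ℕ)) (βA : PMF (Finset (Fin κ))) (μ : Measure ℝ)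
    [IsProbabilityMeasure μ] (σ : Agent κ → Strategy) : Prop :=
  (∀ i, (σ i).Feasible) ∧
    ∀ (i : Agent κ) (v : ℝ) (k : ℕ), 0 ≤ v → ∀ s : Strategy, s.Feasible →
      interimUtility βC βA μ σ i v k (s v k) ≤ interimUtility βC βA μ σ i v k (σ i v k)

/-- Invited agents accept the invitation and report truthfully; an agent who is not in a club
registers and bids `b^e(v, P^{n,1})`, where `n` is the announced number of bidders. -/
def clubStrategy (F : ℝ → ℝ) (γ : PMF ℕ) : Strategy := fun v k =>
  if 2 ≤ k then Action.join v else Action.direct fun n => bidStoch F v (belief γ n 1)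

end BiddingClubs

end

/-! All bids involved have the form b(v) = v − G(v)⁻¹ ∫₀ᵛ G, where G(v) is the probability that
every rival has valuation at most v; for `bidStoch` this G is `topWeight P` composed with F
(`IsBidderLaw.bidStoch_eq`). Such a bid leaves the payoff G(v)(v − b(v)) = ∫₀ᵛ G, and imitating a
type r loses ∫ᵣᵛ G − G(r)(v − r) ≥ 0, because G is monotone (`IsWinProb.payoff_le`). The winning
probability of an arbitrary bid x is a limit of those of types that bid at most x, so no bid beats
b(v) (`IsBidderLaw.deviation_le`). This settles the ordinary auction.

For the club game, fix the set C of coordinators, with n = |C| ≥ 2, and a type (v, k). With φ(s) the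
mean of s^|A_c| (`clubWeight`), the G of P^{n,k} is s^(k−1) φ(s)^(n−1) at s = F(v)
(`topWeight_belief`). If everybody complies, the agent wins, up to ties, when all others present
have lower valuations, and he pays b^e(v, P^{n,k}) in total: he gets the payoff of the ordinary
auction with law P^{n,k} (`le_ofReal_utility_truthful`). A false report r is imitation of type r in
that auction (`ofReal_utility_report_le`).

If he registers on his own, n' = n − 1 + k bidders are announced; clubmates bid by P^{n',k} and
outsiders by P^{n',1}. The corresponding functions G are that of P^{n,k} times φ(s)^(k−1) and
(φ(s)/s)^(k−1). Both factors increase in s, the second because clubs are nonempty, and an increasing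
factor raises bids (`IsWinProb.auctionBid_le_auctionBid_mul`). So the rivals bid at least as in the
P^{n,k} auction, and `IsBidderLaw.deviation_le` applies again. Each comparison holds for every
single C, so averaging over C preserves it. -/

noncomputable section

namespace BiddingClubs

/-! ### Bids generated by a winning probability -/

/-- The bid of an agent with valuation `v` if bidding like an agent with valuation `u` wins with
probability `G u`. -/
def auctionBid (G : ℝ → ℝ) (v : ℝ) : ℝ :=
  open Classical in if G v = 0 then 0 else v - (G v)⁻¹ * ∫ u in (0 : ℝ)..v, G u

/-- A winning probability as a function of the valuation: monotone, nonnegative and vanishing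
at `0`. -/
structure IsWinProb (G : ℝ → ℝ) : Prop where
  mono : Monotone G
  nonneg : ∀ x, 0 ≤ G x
  zero : G 0 = 0

namespace IsWinProb

variable {G : ℝ → ℝ} (hG : IsWinProb G)
include hG

theorem eq_zero_of_nonpos {x : ℝ} (hx : x ≤ 0) : G x = 0 :=
  le_antisymm (hG.zero ▸ hG.mono hx) (hG.nonneg x)

theorem pos_of_ne {x : ℝ} (hx : G x ≠ 0) : 0 < x := by
  by_contra! h
  exact hx (hG.eq_zero_of_nonpos h)

theorem intervalIntegrable (a b : ℝ) : IntervalIntegrable G volume a b :=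
  hG.mono.intervalIntegrable

theorem integral_le {a b : ℝ} (hab : a ≤ b) : ∫ u in a..b, G u ≤ G b * (b - a) := by
  have h := intervalIntegral.integral_mono_on hab (hG.intervalIntegrable a b)
    (intervalIntegrable_const (c := G b)) (fun x hx => hG.mono hx.2)
  simpa [mul_comm] using h

theorem le_integral {a b : ℝ} (hab : a ≤ b) : G a * (b - a) ≤ ∫ u in a..b, G u := by
  have h := intervalIntegral.integral_mono_on hab (intervalIntegrable_const (c := G a))
    (hG.intervalIntegrable a b) (fun x hx => hG.mono hx.1)
  simpa [mul_comm] using h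

/-- Supporting-line inequality for the convex function ∫ G. Having it for both orders of a and b
treats over- and underreporting at once. -/
theorem le_integral' (a b : ℝ) : G a * (b - a) ≤ ∫ u in a..b, G u := by
  rcases le_total a b with hab | hab
  · exact hG.le_integral hab
  · rw [intervalIntegral.integral_symm]
    linarith [hG.integral_le hab]

theorem integral_add (a b : ℝ) :
    (∫ u in (0 : ℝ)..a, G u) + ∫ u in a..b, G u = ∫ u in (0 : ℝ)..b, G u :=
  intervalIntegral.integral_add_adjacent_intervals (hG.intervalIntegrable _ _)
    (hG.intervalIntegrable _ _)

theorem integral_eq_zero {x : ℝ} (hx : G x = 0) : ∫ u in (0 : ℝ)..x, G u = 0 := by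
  have h : ∀ u ∈ Set.uIcc 0 x, G u = 0 := by
    intro u hu
    refine le_antisymm ?_ (hG.nonneg u)
    rcases le_total 0 x with h | h
    · rw [Set.uIcc_of_le h] at hu
      exact hx ▸ hG.mono hu.2
    · rw [Set.uIcc_of_ge h] at hu
      exact hG.zero ▸ hG.mono hu.2
  rw [intervalIntegral.integral_congr (g := fun _ => 0) h]
  simp

/-- The envelope formula free of division: the payoff G(v)(v − b(v)) is ∫₀ᵛ G. The default bid 0 is
harmless because G(v) = 0 forces the integral to vanish. -/
theorem mul_auctionBid (v : ℝ) :
    G v * auctionBid G v = G v * v - ∫ u in (0 : ℝ)..v, G u := by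
  unfold auctionBid
  split_ifs with h
  · rw [hG.integral_eq_zero h, h]; simp
  · field_simp

/-- Bidding like an agent with valuation `r` is not better than bidding like an agent with one's
own valuation. -/
theorem payoff_le (v r : ℝ) :
    G r * (v - auctionBid G r) ≤ G v * (v - auctionBid G v) := by
  have h₁ := hG.mul_auctionBid v
  have h₂ := hG.mul_auctionBid r
  have h₃ := hG.le_integral' r v
  have h₄ := hG.integral_add r v
  nlinarith

theorem payoff_nonneg (v : ℝ) : 0 ≤ G v * (v - auctionBid G v) := by
  have h := hG.payoff_le v 0
  rwa [hG.zero, zero_mul] at h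

theorem auctionBid_le {v : ℝ} (hv : 0 ≤ v) : auctionBid G v ≤ v := by
  unfold auctionBid
  split_ifs with h
  · exact hv
  · have : 0 ≤ (G v)⁻¹ * ∫ u in (0 : ℝ)..v, G u :=
      mul_nonneg (inv_nonneg.2 (hG.nonneg v))
        (intervalIntegral.integral_nonneg hv fun u _ => hG.nonneg u)
    linarith

theorem auctionBid_nonneg (v : ℝ) : 0 ≤ auctionBid G v := by
  by_cases h : G v = 0
  · simp [auctionBid, h]
  · have hp : 0 < G v := lt_of_le_of_ne (hG.nonneg v) (Ne.symm h)
    have h₁ := hG.mul_auctionBid v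
    have h₂ := hG.integral_le (hG.pos_of_ne h).le
    have : 0 ≤ G v * auctionBid G v := by nlinarith
    exact nonneg_of_mul_nonneg_right this hp

/-- The gain in the bid between `r` and `w`. -/
theorem mul_auctionBid_sub (r w : ℝ) :
    G w * (auctionBid G w - auctionBid G r) =
      (G w - G r) * (r - auctionBid G r) + (G w * (w - r) - ∫ u in r..w, G u) := by
  have h₁ := hG.mul_auctionBid w
  have h₂ := hG.mul_auctionBid r
  have h₄ := hG.integral_add r w
  linear_combination h₁ - h₂ + h₄

/-- In `mul_auctionBid_sub` both terms on the right are nonnegative for 0 ≤ r ≤ w. -/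
theorem auctionBid_mono : Monotone (auctionBid G) := by
  intro r w hrw
  by_cases h : G r = 0
  · simpa [auctionBid, h] using hG.auctionBid_nonneg w
  · have hr : 0 < r := hG.pos_of_ne h
    have hw : 0 < G w := (lt_of_le_of_ne (hG.nonneg r) (Ne.symm h)).trans_le (hG.mono hrw)
    have h₁ := hG.mul_auctionBid_sub r w
    have h₂ := hG.integral_le hrw
    have h₃ := mul_nonneg (sub_nonneg.2 (hG.mono hrw)) (sub_nonneg.2 (hG.auctionBid_le hr.le))
    have : 0 ≤ G w * (auctionBid G w - auctionBid G r) := by linarith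
    linarith [nonneg_of_mul_nonneg_right this hw]

/-- Where the winning probability is right-continuous, a higher winning probability requires a
higher bid. -/
theorem auctionBid_lt (hc : ∀ x, ContinuousWithinAt G (Set.Ici x) x) {r w : ℝ}
    (h : G r < G w) : auctionBid G r < auctionBid G w := by
  wlog hr : 0 ≤ r generalizing r
  · have h₀ : G r = 0 := hG.eq_zero_of_nonpos (not_le.1 hr).le
    have := this (r := 0) (by rwa [hG.zero, ← h₀]) le_rfl
    simpa [auctionBid, h₀, hG.zero] using this
  have hrw : r < w := by
    by_contra! hwr
    exact absurd (hG.mono hwr) (not_le.2 h)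
  -- Right-continuity keeps G below G w on a whole interval [r, x], so ∫ᵣʷ G falls short of G w · (w
  -- − r) by at least (G w − G x)(x − r) > 0.
  obtain ⟨x, hx, hxw⟩ : ∃ x, G x < G w ∧ x ∈ Set.Ioo r w := by
    have h₁ : ∀ᶠ x in nhdsWithin r (Set.Ioi r), G x < G w :=
      ((hc r).mono Set.Ioi_subset_Ici_self).eventually (gt_mem_nhds h)
    exact (h₁.and (Ioo_mem_nhdsGT hrw)).exists
  have h₁ := hG.mul_auctionBid_sub r w
  have h₂ := hG.integral_le hxw.1.le
  have h₃ := hG.integral_le hxw.2.le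
  have h₄ : (∫ u in r..x, G u) + ∫ u in x..w, G u = ∫ u in r..w, G u :=
    intervalIntegral.integral_add_adjacent_intervals (hG.intervalIntegrable _ _)
      (hG.intervalIntegrable _ _)
  have h₅ := mul_nonneg (sub_nonneg.2 h.le) (sub_nonneg.2 (hG.auctionBid_le hr))
  have h₆ : 0 < (G w - G x) * (x - r) := mul_pos (sub_pos.2 hx) (sub_pos.2 hxw.1)
  have : 0 < G w * (auctionBid G w - auctionBid G r) := by nlinarith
  linarith [pos_of_mul_pos_right this (hG.nonneg w)]

/-- Multiplying the winning probability by a monotone factor raises the bids. -/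
theorem auctionBid_le_auctionBid_mul {R : ℝ → ℝ} (hR : Monotone R)
    (hpos : ∀ x, G x ≠ 0 → 0 < R x) (hRn : ∀ x, 0 ≤ R x) (v : ℝ) :
    auctionBid G v ≤ auctionBid (fun x => G x * R x) v := by
  have hGR : IsWinProb (fun x => G x * R x) :=
    ⟨fun x y h => mul_le_mul (hG.mono h) (hR h) (hRn x) (hG.nonneg y),
      fun x => mul_nonneg (hG.nonneg x) (hRn x), by simp [hG.zero]⟩
  by_cases h : G v = 0
  · simp [auctionBid, h]
  have hv := hG.pos_of_ne h
  have hRv := hpos v h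
  have hGv : 0 < G v := lt_of_le_of_ne (hG.nonneg v) (Ne.symm h)
  have h₁ : ∫ u in (0 : ℝ)..v, G u * R u ≤ (∫ u in (0 : ℝ)..v, G u) * R v := by
    rw [← intervalIntegral.integral_mul_const]
    exact intervalIntegral.integral_mono_on hv.le (hGR.intervalIntegrable _ _)
      ((hG.intervalIntegrable _ _).mul_const _)
      fun u hu => mul_le_mul_of_nonneg_left (hR hu.2) (hG.nonneg u)
  simp only [auctionBid, h, mul_eq_zero, hRv.ne', or_self, if_false]
  refine sub_le_sub_left ?_ v
  rw [inv_mul_le_iff₀ (mul_pos hGv hRv)]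
  calc _ ≤ _ := h₁
    _ = _ := by field_simp

end IsWinProb

/-! ### Bids for a stochastic number of bidders -/

/-- A law of the number of bidders that is finitely supported on the integers `j ≥ 2`. -/
structure IsBidderLaw (P : PMF ℕ) : Prop where
  finite : P.support.Finite
  two_le : ∀ j ∈ P.support, 2 ≤ j

/-- The probability that the other bidders all lie in an event of probability `s`. -/
def topWeight (P : PMF ℕ) (s : ℝ) : ℝ :=
  ∑' j : ℕ, if 2 ≤ j then (P j).toReal * s ^ (j - 1) else 0

theorem topProb_eq_topWeight (F : ℝ → ℝ) (v : ℝ) (P : PMF ℕ) :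
    topProb F v P = topWeight P (F v) := rfl

namespace IsBidderLaw

variable {P : PMF ℕ} (hP : IsBidderLaw P)
include hP

theorem tsum_eq (f : ℕ → ℝ) :
    (∑' j : ℕ, if 2 ≤ j then (P j).toReal * f j else 0) =
      ∑ j ∈ hP.finite.toFinset, (P j).toReal * f j := by
  rw [tsum_eq_sum (s := hP.finite.toFinset)]
  · refine Finset.sum_congr rfl fun j hj => ?_
    rw [if_pos (hP.two_le j (by simpa using hj))]
  · intro j hj
    have : P j = 0 := by simpa [PMF.mem_support_iff] using hj
    simp [this]

theorem tsum_eq' (f : ℕ → ℝ) :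
    (∑' j : ℕ, (P j).toReal * f j) = ∑ j ∈ hP.finite.toFinset, (P j).toReal * f j := by
  refine tsum_eq_sum fun j hj => ?_
  have : P j = 0 := by simpa [PMF.mem_support_iff] using hj
  simp [this]

theorem topWeight_eq (s : ℝ) :
    topWeight P s = ∑ j ∈ hP.finite.toFinset, (P j).toReal * s ^ (j - 1) :=
  hP.tsum_eq _

theorem pred_ne_zero {j : ℕ} (hj : j ∈ hP.finite.toFinset) : j - 1 ≠ 0 := by
  have := hP.two_le j (by simpa using hj)
  omega

theorem toReal_pos {j : ℕ} (hj : j ∈ hP.finite.toFinset) : 0 < (P j).toReal :=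
  ENNReal.toReal_pos ((P.mem_support_iff j).1 (by simpa using hj)) (P.apply_ne_top j)

theorem topWeight_zero : topWeight P 0 = 0 := by
  rw [hP.topWeight_eq]
  exact Finset.sum_eq_zero fun j hj => by simp [hP.pred_ne_zero hj]

theorem topWeight_nonneg {s : ℝ} (hs : 0 ≤ s) : 0 ≤ topWeight P s := by
  rw [hP.topWeight_eq]
  positivity

theorem topWeight_mono {s t : ℝ} (hs : 0 ≤ s) (hst : s ≤ t) : topWeight P s ≤ topWeight P t := by
  rw [hP.topWeight_eq, hP.topWeight_eq]
  gcongr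

theorem topWeight_lt {s t : ℝ} (hs : 0 ≤ s) (hst : s < t) : topWeight P s < topWeight P t := by
  rw [hP.topWeight_eq, hP.topWeight_eq]
  obtain ⟨j, hj⟩ := P.support_nonempty
  refine Finset.sum_lt_sum_of_nonempty ⟨j, by simpa using hj⟩ fun l hl => ?_
  exact mul_lt_mul_of_pos_left (pow_lt_pow_left₀ hst hs (hP.pred_ne_zero hl)) (hP.toReal_pos hl)

theorem topWeight_pos {s : ℝ} (hs : 0 < s) : 0 < topWeight P s :=
  hP.topWeight_zero ▸ hP.topWeight_lt le_rfl hs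

theorem continuous_topWeight : Continuous (topWeight P) := by
  have : topWeight P = fun s => ∑ j ∈ hP.finite.toFinset, (P j).toReal * s ^ (j - 1) :=
    funext hP.topWeight_eq
  rw [this]
  fun_prop

/-- The equilibrium bid is the bid generated by the probability of having the highest
valuation. -/
theorem bidStoch_eq {F : ℝ → ℝ} (hF : Monotone F) (hF0 : ∀ x, 0 ≤ F x) (v : ℝ) :
    bidStoch F v P = auctionBid (fun x => topWeight P (F x)) v := by
  have hsum : bidStoch F v P = ∑ j ∈ hP.finite.toFinset,
      (P j).toReal * (F v ^ (j - 1) / topWeight P (F v) * bidFixed F v j) := by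
    rw [← hP.tsum_eq]
    unfold bidStoch
    simp only [topProb_eq_topWeight]
    refine tsum_congr fun j => ?_
    split_ifs
    · ring
    · rfl
  rw [hsum]
  unfold auctionBid
  rcases (hF0 v).eq_or_lt with h | h
  · have h₀ : topWeight P (F v) = 0 := by rw [← h, hP.topWeight_zero]
    simp [h₀]
  have hT := hP.topWeight_pos h
  simp only [hT.ne', if_false]
  have hint : ∫ u in (0 : ℝ)..v, topWeight P (F u) =
      ∑ j ∈ hP.finite.toFinset, (P j).toReal * ∫ u in (0 : ℝ)..v, F u ^ (j - 1) := by
    simp only [hP.topWeight_eq]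
    rw [intervalIntegral.integral_finsetSum]
    · simp only [intervalIntegral.integral_const_mul]
    · intro j _
      refine IntervalIntegrable.const_mul ?_ _
      exact Monotone.intervalIntegrable fun x y hxy => pow_le_pow_left₀ (hF0 x) (hF hxy) _
  rw [hint]
  -- Writing v as a weighted mean of copies of itself lets the leading v be distributed over the
  -- summands v − F(v)^(1−j) ∫ F^(j−1).
  have hv : v = (topWeight P (F v))⁻¹ *
      ∑ j ∈ hP.finite.toFinset, (P j).toReal * F v ^ (j - 1) * v := by
    rw [← Finset.sum_mul, ← hP.topWeight_eq]
    field_simp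
  conv_rhs => enter [1]; rw [hv]
  rw [← mul_sub, ← Finset.sum_sub_distrib, Finset.mul_sum]
  refine Finset.sum_congr rfl fun j _ => ?_
  have : F v ^ (j - 1) ≠ 0 := (pow_pos h _).ne'
  unfold bidFixed
  field_simp

end IsBidderLaw

/-! ### The beliefs -/

theorem pmf_tsum_bind {α β : Type*} (p : PMF α) (f : α → PMF β) (g : β → ℝ≥0∞) :
    ∑' b, p.bind f b * g b = ∑' a, p a * ∑' b, f a b * g b := by
  simp only [PMF.bind_apply, ← ENNReal.tsum_mul_right, ← ENNReal.tsum_mul_left]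
  rw [ENNReal.tsum_comm]
  simp only [mul_assoc]

theorem pmf_tsum_pure {β : Type*} (b₀ : β) (g : β → ℝ≥0∞) :
    ∑' b, PMF.pure b₀ b * g b = g b₀ := by
  rw [tsum_eq_single b₀]
  · simp [PMF.pure_apply]
  · intro b hb
    simp [PMF.pure_apply, hb]

theorem pmf_tsum_map {α β : Type*} (p : PMF α) (f : α → β) (g : β → ℝ≥0∞) :
    ∑' b, p.map f b * g b = ∑' a, p a * g (f a) := by
  rw [← PMF.bind_pure_comp, pmf_tsum_bind]
  simp only [Function.comp_apply, pmf_tsum_pure]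

variable {κ : ℕ} (βA : PMF (Finset (Fin κ)))

/-- The probability that all agents of a club lie in an event of probability `s`. -/
def clubWeight (s : ℝ) : ℝ := ∑ A, (βA A).toReal * s ^ A.card

/-- The same as `clubWeight` for an extended nonnegative probability. -/
def clubWeightENN (s : ℝ≥0∞) : ℝ≥0∞ := ∑ A, βA A * s ^ A.card

theorem clubWeightENN_ofReal {s : ℝ} (hs : 0 ≤ s) :
    clubWeightENN βA (ENNReal.ofReal s) = ENNReal.ofReal (clubWeight βA s) := by
  unfold clubWeight clubWeightENN
  rw [ENNReal.ofReal_sum_of_nonneg fun A _ => by positivity]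
  refine Finset.sum_congr rfl fun A _ => ?_
  rw [ENNReal.ofReal_mul ENNReal.toReal_nonneg, ENNReal.ofReal_toReal (βA.apply_ne_top A),
    ENNReal.ofReal_pow hs]

theorem clubWeight_nonneg {s : ℝ} (hs : 0 ≤ s) : 0 ≤ clubWeight βA s := by
  unfold clubWeight
  positivity

/-- Generating functions of independent sums multiply. Values in `ℝ≥0∞` allow sums to be
interchanged without summability conditions. -/
theorem tsum_iidSum_mul_pow (m : ℕ) (s : ℝ≥0∞) :
    ∑' j, iidSum (βA.map Finset.card) m j * s ^ j = clubWeightENN βA s ^ m := by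
  induction m with
  | zero => simp only [iidSum, pmf_tsum_pure, pow_zero]
  | succ m ih =>
    simp only [iidSum, pmf_tsum_bind, pmf_tsum_map, pow_add, pow_one]
    have h : ∀ a, ∑' A, βA A * (s ^ a * s ^ A.card) = s ^ a * clubWeightENN βA s := by
      intro a
      rw [tsum_fintype, clubWeightENN, Finset.mul_sum]
      exact Finset.sum_congr rfl fun A _ => by ring
    simp only [h]
    simp only [← mul_assoc, ENNReal.tsum_mul_right, ih]

variable {βA}

theorem card_pos_of_mem_support (hA0 : (βA.map Finset.card) 0 = 0) {A : Finset (Fin κ)}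
    (hA : A ∈ βA.support) : 0 < A.card := by
  rw [Finset.card_pos, Finset.nonempty_iff_ne_empty]
  rintro rfl
  have : (0 : ℕ) ∈ (βA.map Finset.card).support := by
    rw [PMF.mem_support_map_iff]
    exact ⟨∅, hA, rfl⟩
  exact (PMF.mem_support_iff _ _).1 this hA0

theorem iidSum_support_finite (m : ℕ) : (iidSum (βA.map Finset.card) m).support.Finite := by
  induction m with
  | zero => simp [iidSum]
  | succ m ih =>
    rw [iidSum, PMF.support_bind]
    refine ih.biUnion fun s _ => ?_
    rw [PMF.support_map, PMF.support_map]
    exact ((Set.toFinite _).image _).image _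

theorem le_of_mem_iidSum_support (hA0 : (βA.map Finset.card) 0 = 0) (m : ℕ) :
    ∀ j ∈ (iidSum (βA.map Finset.card) m).support, m ≤ j := by
  induction m with
  | zero => simp
  | succ m ih =>
    intro j hj
    rw [iidSum, PMF.mem_support_bind_iff] at hj
    obtain ⟨s, hs, hj⟩ := hj
    rw [PMF.mem_support_map_iff] at hj
    obtain ⟨t, ht, rfl⟩ := hj
    rw [PMF.mem_support_map_iff] at ht
    obtain ⟨A, hA, rfl⟩ := ht
    have := ih s hs
    have := card_pos_of_mem_support hA0 hA
    omega

theorem isBidderLaw_belief (hA0 : (βA.map Finset.card) 0 = 0) {n k : ℕ} (hn : 2 ≤ n)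
    (hk : 1 ≤ k) : IsBidderLaw (belief (βA.map Finset.card) n k) := by
  constructor
  · rw [belief, PMF.support_map]
    exact (iidSum_support_finite _).image _
  · intro j hj
    rw [belief, PMF.mem_support_map_iff] at hj
    obtain ⟨s, hs, rfl⟩ := hj
    have := le_of_mem_iidSum_support hA0 _ s hs
    omega

/-- The probability that all the other bidders lie in an event of probability `s`, if there are `n`
clubs, one of which has `k` members. -/
theorem topWeight_belief (hA0 : (βA.map Finset.card) 0 = 0) {n k : ℕ} (hn : 2 ≤ n)
    (hk : 1 ≤ k) {s : ℝ} (hs : 0 ≤ s) :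
    topWeight (belief (βA.map Finset.card) n k) s = s ^ (k - 1) * clubWeight βA s ^ (n - 1) := by
  have hP := isBidderLaw_belief hA0 hn hk
  rw [hP.topWeight_eq, ← hP.tsum_eq']
  have h₁ : ∑' j, belief (βA.map Finset.card) n k j * ENNReal.ofReal s ^ (j - 1) =
      ENNReal.ofReal (s ^ (k - 1) * clubWeight βA s ^ (n - 1)) := by
    rw [belief, pmf_tsum_map]
    -- This is where 1 ≤ k enters: the truncated subtraction removes the agent himself from his own
    -- club.
    have : ∀ a, k + a - 1 = (k - 1) + a := fun a => by omega
    simp only [this, pow_add, mul_left_comm _ (ENNReal.ofReal s ^ (k - 1)), ENNReal.tsum_mul_left,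
      tsum_iidSum_mul_pow]
    rw [ENNReal.ofReal_mul (by positivity), ENNReal.ofReal_pow hs,
      ENNReal.ofReal_pow (clubWeight_nonneg βA hs), clubWeightENN_ofReal βA hs]
  have h₂ := congrArg ENNReal.toReal h₁
  rw [ENNReal.toReal_ofReal (mul_nonneg (by positivity)
    (pow_nonneg (clubWeight_nonneg βA hs) _)), ENNReal.tsum_toReal_eq] at h₂
  · rw [← h₂]
    refine tsum_congr fun j => ?_
    rw [ENNReal.toReal_mul, ENNReal.toReal_pow, ENNReal.toReal_ofReal hs]
  · intro j
    exact ENNReal.mul_ne_top (PMF.apply_ne_top _ _) (ENNReal.pow_ne_top ENNReal.ofReal_ne_top)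

theorem clubWeight_mono {s t : ℝ} (hs : 0 ≤ s) (hst : s ≤ t) :
    clubWeight βA s ≤ clubWeight βA t := by
  unfold clubWeight
  gcongr

variable (βA) in
/-- The probability that all the other agents of the club of a randomly drawn agent lie in an event
of probability `s`. -/
def clubWeightPred (s : ℝ) : ℝ := ∑ A, (βA A).toReal * s ^ (A.card - 1)

/-- Empty clubs have probability zero, so `A.card - 1` is never truncated where it counts. Hence
φ(s)/s is again a polynomial with nonnegative coefficients, and so increasing on s ≥ 0. -/
theorem clubWeight_eq_mul (hA0 : (βA.map Finset.card) 0 = 0) (s : ℝ) :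
    clubWeight βA s = s * clubWeightPred βA s := by
  unfold clubWeight clubWeightPred
  rw [Finset.mul_sum]
  refine Finset.sum_congr rfl fun A _ => ?_
  by_cases hA : βA A = 0
  · simp [hA]
  · obtain ⟨m, hm⟩ := Nat.exists_eq_succ_of_ne_zero
      (card_pos_of_mem_support hA0 ((βA.mem_support_iff A).2 hA)).ne'
    rw [hm, Nat.succ_sub_one, pow_succ]
    ring

theorem clubWeightPred_nonneg {s : ℝ} (hs : 0 ≤ s) : 0 ≤ clubWeightPred βA s := by
  unfold clubWeightPred
  positivity

theorem clubWeightPred_mono {s t : ℝ} (hs : 0 ≤ s) (hst : s ≤ t) :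
    clubWeightPred βA s ≤ clubWeightPred βA t := by
  unfold clubWeightPred
  gcongr

theorem clubWeightPred_pos {s : ℝ} (hs : 0 < s) : 0 < clubWeightPred βA s := by
  unfold clubWeightPred
  obtain ⟨A, hA⟩ := βA.support_nonempty
  refine Finset.sum_pos' (fun A _ => by positivity) ⟨A, Finset.mem_univ A, ?_⟩
  exact mul_pos (ENNReal.toReal_pos ((βA.mem_support_iff A).1 hA) (βA.apply_ne_top A))
    (pow_pos hs _)

/-! ### Atomless valuations -/

theorem IsBidderLaw.bidStoch_cdf {μ : Measure ℝ} {P : PMF ℕ} (hP : IsBidderLaw P) (v : ℝ) :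
    bidStoch (cdf μ) v P = auctionBid (fun x => topWeight P (cdf μ x)) v :=
  hP.bidStoch_eq (monotone_cdf μ) (cdf_nonneg μ) v

section Atomless

open Filter Topology

variable (μ : Measure ℝ) [IsProbabilityMeasure μ] [NullSingletonClass μ]

/-- A jump of the distribution function would be the mass of an atom. -/
theorem continuous_cdf : Continuous (cdf μ) := by
  rw [continuous_iff_continuousAt]
  intro x
  rw [(cdf μ).mono.continuousAt_iff_leftLim_eq_rightLim, StieltjesFunction.rightLim_eq]
  have h : (cdf μ).measure {x} = 0 := by
    rw [measure_cdf]
    exact measure_singleton x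
  rw [StieltjesFunction.measure_singleton, ENNReal.ofReal_eq_zero] at h
  exact le_antisymm ((cdf μ).mono.leftLim_le le_rfl) (by linarith)

theorem cdf_zero (hμ : μ (Set.Iio 0) = 0) : cdf μ 0 = 0 := by
  rw [cdf_eq_real, measureReal_def, measure_congr (Iio_ae_eq_Iic (a := (0 : ℝ))).symm, hμ]
  rfl

/-- The probability of a lower set is approximated by the distribution function on that set. -/
theorem exists_seq_tendsto_cdf {L : Set ℝ} (hL : IsLowerSet L) (hne : L.Nonempty) :
    ∃ r : ℕ → ℝ, (∀ m, r m ∈ L) ∧ Tendsto (fun m => cdf μ (r m)) atTop (𝓝 (μ.real L)) := by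
  by_cases hb : BddAbove L
  · by_cases hs : sSup L ∈ L
    · refine ⟨fun _ => sSup L, fun _ => hs, ?_⟩
      have : L = Set.Iic (sSup L) :=
        Set.Subset.antisymm (fun x hx => le_csSup hb hx) (hL.Iic_subset hs)
      have h₁ : cdf μ (sSup L) = μ.real L := by rw [cdf_eq_real, ← this]
      simp only [h₁]
      exact tendsto_const_nhds
    · have hlt : ∀ x ∈ L, x < sSup L := fun x hx =>
        lt_of_le_of_ne (le_csSup hb hx) fun h => hs (h ▸ hx)
      have : L = Set.Iio (sSup L) := by
        refine Set.Subset.antisymm hlt fun x hx => ?_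
        obtain ⟨y, hy, hxy⟩ := exists_lt_of_lt_csSup hne hx
        exact hL hxy.le hy
      obtain ⟨r, -, hr, hrt⟩ := exists_seq_strictMono_tendsto (sSup L)
      refine ⟨r, fun m => this ▸ hr m, ?_⟩
      have h₁ : μ.real L = cdf μ (sSup L) := by
        rw [cdf_eq_real, measureReal_def, measureReal_def,
          ← measure_congr (Iio_ae_eq_Iic (a := sSup L)), ← this]
      rw [h₁]
      exact ((continuous_cdf μ).tendsto _).comp hrt
  · have : L = Set.univ := by
      refine Set.eq_univ_of_forall fun x => ?_
      obtain ⟨y, hy, hxy⟩ := not_bddAbove_iff.1 hb x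
      exact hL hxy.le hy
    subst this
    refine ⟨fun m => m, fun _ => trivial, ?_⟩
    simpa using! (tendsto_cdf_atTop μ).comp tendsto_natCast_atTop_atTop

/-- Where F is flat the set exceeds (−∞, r], but only by a null set: points of the set approximating
its measure all have F ≤ F r. -/
theorem measureReal_cdf_le (r : ℝ) : μ.real {w | cdf μ w ≤ cdf μ r} = cdf μ r := by
  refine le_antisymm ?_ ?_
  · obtain ⟨x, hx, hxt⟩ := exists_seq_tendsto_cdf μ
      (L := {w | cdf μ w ≤ cdf μ r}) (fun a b hba ha => (monotone_cdf μ hba).trans ha) ⟨r, le_refl (cdf μ r)⟩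
    exact le_of_tendsto' hxt hx
  · have h : Set.Iic r ⊆ {w | cdf μ w ≤ cdf μ r} := fun w hw => monotone_cdf μ hw
    calc cdf μ r = μ.real (Set.Iic r) := cdf_eq_real μ r
      _ ≤ _ := measureReal_mono h

/-- Continuity lets F take every level s in (0, F v), say at w, and then (−∞, w] lies in the set.
Together with `measureReal_cdf_le`, ties in F have probability zero, so strict and weak winning
events are equally likely. -/
theorem measureReal_cdf_lt (v : ℝ) : μ.real {w | cdf μ w < cdf μ v} = cdf μ v := by
  refine le_antisymm ?_ (le_of_forall_lt fun t ht => ?_)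
  · have h : {w | cdf μ w < cdf μ v} ⊆ {w | cdf μ w ≤ cdf μ v} :=
      fun w (hw : cdf μ w < cdf μ v) => hw.le
    exact (measureReal_mono h).trans_eq (measureReal_cdf_le μ v)
  · rcases lt_or_ge t 0 with h₀ | h₀
    · exact h₀.trans_le measureReal_nonneg
    obtain ⟨s, hts, hsv⟩ := exists_between ht
    obtain ⟨w₀, hw₀⟩ := ((tendsto_cdf_atBot μ).eventually (gt_mem_nhds (h₀.trans_lt hts))).exists
    have hle : w₀ ≤ v := by
      by_contra! h
      exact absurd ((monotone_cdf μ h.le).trans_lt hw₀) (not_lt.2 hsv.le)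
    obtain ⟨w, -, hw⟩ := intermediate_value_Icc hle (continuous_cdf μ).continuousOn
      ⟨hw₀.le, hsv.le⟩
    calc t < s := hts
      _ = μ.real (Set.Iic w) := by rw [← cdf_eq_real, hw]
      _ ≤ _ := measureReal_mono fun x hx =>
        (monotone_cdf μ hx).trans_lt (hw.trans_lt hsv)

variable {μ} {P : PMF ℕ} (hP : IsBidderLaw P) (hμ : μ (Set.Iio 0) = 0)
include hP hμ

theorem IsBidderLaw.isWinProb : IsWinProb fun x => topWeight P (cdf μ x) where
  mono _ _ h := hP.topWeight_mono (cdf_nonneg μ _) (monotone_cdf μ h)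
  nonneg _ := hP.topWeight_nonneg (cdf_nonneg μ _)
  zero := by rw [cdf_zero μ hμ, hP.topWeight_zero]

theorem IsBidderLaw.bidStoch_mono : Monotone fun v => bidStoch (cdf μ) v P := by
  simp only [hP.bidStoch_cdf]
  exact (hP.isWinProb hμ).auctionBid_mono

theorem IsBidderLaw.bidStoch_le {v : ℝ} (hv : 0 ≤ v) : bidStoch (cdf μ) v P ≤ v := by
  rw [hP.bidStoch_cdf]
  exact (hP.isWinProb hμ).auctionBid_le hv

theorem IsBidderLaw.bidStoch_lt {r w : ℝ} (h : cdf μ r < cdf μ w) :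
    bidStoch (cdf μ) r P < bidStoch (cdf μ) w P := by
  rw [hP.bidStoch_cdf, hP.bidStoch_cdf]
  exact (hP.isWinProb hμ).auctionBid_lt
    (fun x => (hP.continuous_topWeight.comp (continuous_cdf μ)).continuousWithinAt)
    (hP.topWeight_lt (cdf_nonneg μ _) h)

theorem IsBidderLaw.payoff_le (v r : ℝ) :
    topWeight P (cdf μ r) * (v - bidStoch (cdf μ) r P) ≤
      topWeight P (cdf μ v) * (v - bidStoch (cdf μ) v P) := by
  rw [hP.bidStoch_cdf, hP.bidStoch_cdf]
  exact (hP.isWinProb hμ).payoff_le v r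

theorem IsBidderLaw.payoff_nonneg (v : ℝ) :
    0 ≤ topWeight P (cdf μ v) * (v - bidStoch (cdf μ) v P) := by
  rw [hP.bidStoch_cdf]
  exact (hP.isWinProb hμ).payoff_nonneg v

/-- No bid `x` does better than the equilibrium bid against bidders who follow the equilibrium. -/
theorem IsBidderLaw.deviation_le (v x : ℝ) :
    topWeight P (μ.real {w | bidStoch (cdf μ) w P ≤ x}) * (v - x) ≤
      topWeight P (cdf μ v) * (v - bidStoch (cdf μ) v P) := by
  rcases Set.eq_empty_or_nonempty {w | bidStoch (cdf μ) w P ≤ x} with he | hne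
  · rw [he, measureReal_empty, hP.topWeight_zero, zero_mul]
    exact hP.payoff_nonneg hμ v
  -- The valuations bidding at most x form a lower set. Types r m inside it win with probabilities
  -- tending to that of x and pay no more than x, so `payoff_le` bounds the payoff of x in the
  -- limit, even if no type bids x.
  · obtain ⟨r, hr, hrt⟩ := exists_seq_tendsto_cdf μ
      (fun a b hba ha => (hP.bidStoch_mono hμ hba).trans ha) hne
    refine le_of_tendsto'
      (((hP.continuous_topWeight.tendsto _).comp hrt).mul_const (v - x)) fun m => ?_
    refine (mul_le_mul_of_nonneg_left ?_ ?_).trans (hP.payoff_le hμ v (r m))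
    · have : bidStoch (cdf μ) (r m) P ≤ x := hr m
      linarith
    · exact hP.topWeight_nonneg (cdf_nonneg μ _)

end Atomless

/-! ### The ordinary first-price auction -/

section FirstPrice

variable {μ : Measure ℝ} [IsProbabilityMeasure μ]

theorem integral_pi_indicator_const {m : ℕ} {L : Set ℝ} (hL : MeasurableSet L) (c : ℝ) :
    ∫ w : Fin m → ℝ, (Set.univ.pi fun _ => L).indicator (fun _ => c) w
      ∂(Measure.pi fun _ => μ) = c * μ.real L ^ m := by
  rw [integral_indicator (MeasurableSet.univ_pi fun _ => hL), setIntegral_const, measureReal_def,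
    Measure.pi_pi, Finset.prod_const, Finset.card_univ, Fintype.card_fin, ENNReal.toReal_pow,
    smul_eq_mul, mul_comm, measureReal_def]

theorem integrable_pi_indicator_const {m : ℕ} {L : Set ℝ} (hL : MeasurableSet L) (c : ℝ) :
    Integrable ((Set.univ.pi fun _ => L).indicator fun _ => c)
      (Measure.pi fun _ : Fin m => μ) :=
  (integrable_const c).indicator (MeasurableSet.univ_pi fun _ => hL)

theorem div_one_add_le {c : ℝ} (hc : 0 ≤ c) (m : ℕ) : c / (1 + m : ℕ) ≤ c :=
  div_le_self hc (by exact_mod_cast Nat.le_add_right 1 m)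

theorem firstPriceUtility_le {v x : ℝ} {m : ℕ} (y : Fin m → ℝ) :
    firstPriceUtility v x y ≤ max (v - x) 0 := by
  unfold firstPriceUtility
  split_ifs
  · rcases le_total 0 (v - x) with h | h
    · exact (div_one_add_le h _).trans (le_max_left _ _)
    · exact (div_nonpos_of_nonpos_of_nonneg h (Nat.cast_nonneg _)).trans (le_max_right _ _)
  · exact le_max_right _ _

theorem firstPriceUtility_nonneg {v x : ℝ} (h : x ≤ v) {m : ℕ} (y : Fin m → ℝ) :
    0 ≤ firstPriceUtility v x y := by
  unfold firstPriceUtility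
  split_ifs
  · exact div_nonneg (sub_nonneg.2 h) (Nat.cast_nonneg _)
  · exact le_rfl

theorem firstPriceUtility_nonpos {v x : ℝ} (h : v ≤ x) {m : ℕ} (y : Fin m → ℝ) :
    firstPriceUtility v x y ≤ 0 :=
  firstPriceUtility_le y |>.trans (by rw [max_eq_right (sub_nonpos.2 h)])

theorem measurable_firstPriceUtility {b : ℝ → ℝ} (hb : Measurable b) (v x : ℝ) (m : ℕ) :
    Measurable fun w : Fin m → ℝ => firstPriceUtility v x fun l => b (w l) := by
  classical
  unfold firstPriceUtility
  refine Measurable.ite ?_ ?_ measurable_const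
  · rw [Set.ofPred_forall]
    exact MeasurableSet.iInter fun l =>
      measurableSet_le (hb.comp (measurable_pi_apply l)) measurable_const
  · refine Measurable.const_div ?_ _
    simp only [Finset.card_filter, Nat.cast_add, Nat.cast_sum]
    refine Measurable.const_add (Finset.measurable_sum _ fun l _ => ?_) _
    simp only [Nat.cast_ite]
    exact Measurable.ite (measurableSet_eq_fun (hb.comp (measurable_pi_apply l)) measurable_const)
      measurable_const measurable_const

theorem integral_firstPriceUtility_le {b : ℝ → ℝ} (hb : Measurable b) (v x : ℝ) (m : ℕ) :
    ∫ w : Fin m → ℝ, firstPriceUtility v x (fun l => b (w l)) ∂(Measure.pi fun _ => μ) ≤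
      max (v - x) 0 * μ.real {w | b w ≤ x} ^ m := by
  have hL : MeasurableSet {w | b w ≤ x} := measurableSet_le hb measurable_const
  rcases le_total v x with h | h
  · refine (integral_nonpos fun w => firstPriceUtility_nonpos h _).trans ?_
    exact mul_nonneg (le_max_right _ _) (pow_nonneg measureReal_nonneg _)
  · rw [← integral_pi_indicator_const hL]
    refine integral_mono_of_nonneg (ae_of_all _ fun w => firstPriceUtility_nonneg h _)
      (integrable_pi_indicator_const hL _) (ae_of_all _ fun w => ?_)
    by_cases hw : w ∈ Set.univ.pi fun _ : Fin m => {w | b w ≤ x}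
    · simp only [Set.indicator_of_mem hw]
      exact firstPriceUtility_le _
    · simp only [Set.indicator_of_notMem hw]
      have : ¬ ∀ l, b (w l) ≤ x := by simpa using hw
      simp [firstPriceUtility, this]

theorem le_integral_firstPriceUtility {b : ℝ → ℝ} (hb : Measurable b) {v x : ℝ} (h : x ≤ v)
    {L : Set ℝ} (hL : MeasurableSet L) (hbL : ∀ w ∈ L, b w < x) (m : ℕ) :
    (v - x) * μ.real L ^ m ≤
      ∫ w : Fin m → ℝ, firstPriceUtility v x (fun l => b (w l)) ∂(Measure.pi fun _ => μ) := by
  rw [← integral_pi_indicator_const hL]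
  refine integral_mono (integrable_pi_indicator_const hL _) ?_ fun w => ?_
  · refine Integrable.of_bound (measurable_firstPriceUtility hb v x m).aestronglyMeasurable
      (max (v - x) 0) (ae_of_all _ fun w => ?_)
    rw [Real.norm_of_nonneg (firstPriceUtility_nonneg h _)]
    exact firstPriceUtility_le _
  · by_cases hw : w ∈ Set.univ.pi fun _ : Fin m => L
    · simp only [Set.indicator_of_mem hw]
      have hlt : ∀ l, b (w l) < x := fun l => hbL _ (hw l trivial)
      simp [firstPriceUtility, fun l => (hlt l).le, fun l => (hlt l).ne]
    · simp only [Set.indicator_of_notMem hw]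
      exact firstPriceUtility_nonneg h _

/-- The equilibrium bids are a symmetric equilibrium of the first-price auction with a stochastic
number of bidders. -/
theorem IsBidderLaw.isSymmetricEquilibrium [NullSingletonClass μ] (hμ : μ (Set.Iio 0) = 0)
    {P : PMF ℕ} (hP : IsBidderLaw P) :
    IsSymmetricEquilibrium μ P fun v => bidStoch (cdf μ) v P := by
  intro v hv x
  set b : ℝ → ℝ := fun v => bidStoch (cdf μ) v P with hb_def
  have hb : Measurable b := (hP.bidStoch_mono hμ).measurable
  unfold stochUtility
  rw [hP.tsum_eq, hP.tsum_eq]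
  -- The deviation is bounded above by counting every tie as a win at a nonnegative margin, the
  -- equilibrium payoff below by counting only strict wins. The two bounds meet in `deviation_le`
  -- because ties in F are null.
  calc _ ≤ ∑ j ∈ hP.finite.toFinset,
        (P j).toReal * (max (v - x) 0 * μ.real {w | b w ≤ x} ^ (j - 1)) :=
        Finset.sum_le_sum fun j _ =>
          mul_le_mul_of_nonneg_left (integral_firstPriceUtility_le hb v x _) ENNReal.toReal_nonneg
    _ = topWeight P (μ.real {w | b w ≤ x}) * max (v - x) 0 := by
        rw [hP.topWeight_eq, Finset.sum_mul]
        exact Finset.sum_congr rfl fun j _ => by ring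
    _ ≤ topWeight P (cdf μ v) * (v - b v) := by
        rcases le_total (v - x) 0 with h | h
        · rw [max_eq_right h, mul_zero]
          exact hP.payoff_nonneg hμ v
        · rw [max_eq_left h]
          exact hP.deviation_le hμ v x
    _ = ∑ j ∈ hP.finite.toFinset,
        (P j).toReal * ((v - b v) * μ.real {w | cdf μ w < cdf μ v} ^ (j - 1)) := by
        rw [hP.topWeight_eq, Finset.sum_mul, measureReal_cdf_lt]
        exact Finset.sum_congr rfl fun j _ => by ring
    _ ≤ _ := Finset.sum_le_sum fun j _ =>
        mul_le_mul_of_nonneg_left (le_integral_firstPriceUtility hb (hP.bidStoch_le hμ hv)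
          (measurableSet_lt (monotone_cdf μ).measurable measurable_const)
          (fun w hw => hP.bidStoch_lt hμ hw) _) ENNReal.toReal_nonneg

end FirstPrice

/-! ### Comparison of bids -/

section Comparison

variable {μ : Measure ℝ} [IsProbabilityMeasure μ] [NullSingletonClass μ] (hμ : μ (Set.Iio 0) = 0)
  {κ : ℕ} {βA : PMF (Finset (Fin κ))} (hA0 : (βA.map Finset.card) 0 = 0)
include hμ hA0

/-- If one winning probability is the other times an increasing factor R, the first puts relatively
more weight on high valuations, and bids rise. -/
theorem bidStoch_le_of_factor {n k n' k' : ℕ} (hn : 2 ≤ n) (hk : 1 ≤ k) (hn' : 2 ≤ n')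
    (hk' : 1 ≤ k') {R : ℝ → ℝ} (hRn : ∀ s, 0 ≤ s → 0 ≤ R s) (hRp : ∀ s, 0 < s → 0 < R s)
    (hRm : ∀ s t, 0 ≤ s → s ≤ t → R s ≤ R t)
    (hR : ∀ s, 0 ≤ s → s ^ (k' - 1) * clubWeight βA s ^ (n' - 1) =
      s ^ (k - 1) * clubWeight βA s ^ (n - 1) * R s) (v : ℝ) :
    bidStoch (cdf μ) v (belief (βA.map Finset.card) n k) ≤
      bidStoch (cdf μ) v (belief (βA.map Finset.card) n' k') := by
  have hP := isBidderLaw_belief hA0 hn hk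
  have hP' := isBidderLaw_belief hA0 hn' hk'
  rw [hP.bidStoch_cdf, hP'.bidStoch_cdf]
  have h : (fun x => topWeight (belief (βA.map Finset.card) n' k') (cdf μ x)) =
      fun x => topWeight (belief (βA.map Finset.card) n k) (cdf μ x) * R (cdf μ x) := by
    funext x
    rw [topWeight_belief hA0 hn' hk' (cdf_nonneg μ x), topWeight_belief hA0 hn hk (cdf_nonneg μ x),
      hR _ (cdf_nonneg μ x)]
  rw [h]
  refine (hP.isWinProb hμ).auctionBid_le_auctionBid_mul
    (fun x y hxy => hRm _ _ (cdf_nonneg μ x) (monotone_cdf μ hxy)) (fun x hx => hRp _ ?_)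
    (fun x => hRn _ (cdf_nonneg μ x)) v
  refine lt_of_le_of_ne (cdf_nonneg μ x) fun h₀ => hx ?_
  rw [← h₀, hP.topWeight_zero]

/-- Bidders outside the club bid more if the `k` members of a club are announced individually. -/
theorem bidStoch_le_bidStoch_one {n k : ℕ} (hn : 2 ≤ n) (hk : 1 ≤ k) (v : ℝ) :
    bidStoch (cdf μ) v (belief (βA.map Finset.card) n k) ≤
      bidStoch (cdf μ) v (belief (βA.map Finset.card) (n - 1 + k) 1) := by
  refine bidStoch_le_of_factor hμ hA0 hn hk (by omega) le_rfl
    (R := fun s => clubWeightPred βA s ^ (k - 1))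
    (fun s hs => pow_nonneg (clubWeightPred_nonneg hs) _)
    (fun s hs => pow_pos (clubWeightPred_pos hs) _)
    (fun s t hs hst => pow_le_pow_left₀ (clubWeightPred_nonneg hs) (clubWeightPred_mono hs hst) _)
    (fun s _ => ?_) v
  have : n - 1 + k - 1 = (n - 1) + (k - 1) := by omega
  rw [this, pow_add, clubWeight_eq_mul hA0, mul_pow, mul_pow]
  ring

/-- Club members bid more if the `k` members of their club are announced individually. -/
theorem bidStoch_le_bidStoch_self {n k : ℕ} (hn : 2 ≤ n) (hk : 1 ≤ k) (v : ℝ) :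
    bidStoch (cdf μ) v (belief (βA.map Finset.card) n k) ≤
      bidStoch (cdf μ) v (belief (βA.map Finset.card) (n - 1 + k) k) := by
  refine bidStoch_le_of_factor hμ hA0 hn hk (by omega) hk
    (R := fun s => clubWeight βA s ^ (k - 1))
    (fun s hs => pow_nonneg (clubWeight_nonneg βA hs) _)
    (fun s hs => pow_pos ?_ _)
    (fun s t hs hst => pow_le_pow_left₀ (clubWeight_nonneg βA hs) (clubWeight_mono hs hst) _)
    (fun s _ => ?_) v
  · rw [clubWeight_eq_mul hA0]
    exact mul_pos hs (clubWeightPred_pos hs)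
  · have : n - 1 + k - 1 = (n - 1) + (k - 1) := by omega
    rw [this, pow_add]
    ring

end Comparison

/-! ### Outcomes of the mechanism -/

section Outcomes

variable {κ : ℕ} {F : ℝ → ℝ} {γ : PMF ℕ} {C : Finset ℕ} {A : ℕ → Finset (Fin κ)}
  {act : Agent κ → Action}

open Classical in
theorem mem_bidders {i : Agent κ} : i ∈ bidders C A act ↔
    i.1 ∈ C ∧ i.2 ∈ A i.1 ∧ if AllJoin A act i.1 then IsTop A act i else act i ≠ .abstain := by
  simp [bidders, Finset.mem_product]

theorem mem_winners {i : Agent κ} : i ∈ winners F γ C A act ↔ i ∈ bidders C A act ∧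
    ∀ j ∈ bidders C A act, mainBid F γ C A act j ≤ mainBid F γ C A act i := by
  simp [winners]

theorem existsUnique_isTop (act : Agent κ → Action) {c : ℕ} (h : (A c).Nonempty) :
    ∃! a, a ∈ A c ∧ IsTop A act (c, a) := by
  -- Maximizing lexicographically with the index order reversed encodes the tie-break in favour of
  -- the lowest index.
  obtain ⟨a, ha, hmax⟩ := (A c).exists_max_image
    (fun a => toLex ((act (c, a)).report, OrderDual.toDual a)) h
  refine ⟨a, ⟨ha, fun a' ha' => ?_⟩, fun a' ⟨ha', htop⟩ => ?_⟩
  · have := hmax a' ha'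
    rw [Prod.Lex.toLex_le_toLex] at this
    simpa using! this
  · have h₁ := hmax a' ha'
    rw [Prod.Lex.toLex_le_toLex] at h₁
    have h₂ := htop a ha
    simp only [OrderDual.toDual_le_toDual] at h₁ h₂
    rcases h₁ with h₁ | ⟨h₁, h₁'⟩ <;> rcases h₂ with h₂ | ⟨h₂, h₂'⟩
    · exact absurd h₁ h₂.not_gt
    · exact absurd h₁ h₂.not_gt
    · exact absurd h₂ h₁.not_gt
    · exact le_antisymm h₂' h₁'

theorem existsUnique_bidder_of_allJoin {c : ℕ} (hc : c ∈ C) (h : (A c).Nonempty)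
    (hj : AllJoin A act c) : ∃! a, (c, a) ∈ bidders C A act := by
  simpa [mem_bidders, hc, hj] using existsUnique_isTop act h

theorem mem_bidders_of_not_allJoin {c : ℕ} (hc : c ∈ C) (hj : ¬ AllJoin A act c)
    (hab : ∀ a ∈ A c, act (c, a) ≠ .abstain) {a : Fin κ} :
    (c, a) ∈ bidders C A act ↔ a ∈ A c := by
  simp only [mem_bidders, hc, hj, if_false, true_and]
  exact ⟨fun h => h.1, fun h => ⟨h, hab a h⟩⟩

theorem announced_eq_sum :
    announced C A act = ∑ c ∈ C, (Finset.univ.filter fun a => (c, a) ∈ bidders C A act).card := by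
  rw [announced, Finset.card_eq_sum_card_fiberwise (f := Prod.fst) (t := C)
    fun i hi => (mem_bidders.1 hi).1]
  refine Finset.sum_congr rfl fun c _ => ?_
  refine Finset.card_bij (fun i _ => i.2) ?_ ?_ ?_
  · rintro ⟨c', a⟩ h
    rw [Finset.mem_filter] at h
    obtain ⟨h, rfl⟩ := h
    simpa using h
  · rintro ⟨c₁, a₁⟩ h₁ ⟨c₂, a₂⟩ h₂ h
    rw [Finset.mem_filter] at h₁ h₂
    exact Prod.ext (h₁.2.trans h₂.2.symm) h
  · intro a ha
    exact ⟨(c, a), by simpa using ha, rfl⟩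

/-- The agents of coordinator `c` follow the club strategy, as if their valuations were `u`. -/
def FollowsClub (F : ℝ → ℝ) (γ : PMF ℕ) (A : ℕ → Finset (Fin κ)) (act : Agent κ → Action)
    (u : Agent κ → ℝ) (c : ℕ) : Prop :=
  ∀ a ∈ A c, act (c, a) = clubStrategy F γ (u (c, a)) (A c).card

theorem clubStrategy_of_two_le {k : ℕ} (hk : 2 ≤ k) (v : ℝ) :
    clubStrategy F γ v k = .join v := by simp [clubStrategy, hk]

theorem clubStrategy_of_lt {k : ℕ} (hk : k < 2) (v : ℝ) :
    clubStrategy F γ v k = .direct fun n => bidStoch F v (belief γ n 1) := by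
  simp [clubStrategy, hk]

theorem clubStrategy_ne_abstain (k : ℕ) (v : ℝ) : clubStrategy F γ v k ≠ .abstain := by
  unfold clubStrategy
  split_ifs <;> simp

namespace FollowsClub

variable {u : Agent κ → ℝ} {c : ℕ} (h : FollowsClub F γ A act u c)
include h

theorem allJoin (hk : 2 ≤ (A c).card) : AllJoin A act c := by
  intro a ha
  rw [h a ha, clubStrategy_of_two_le hk]
  trivial

theorem not_allJoin (hne : (A c).Nonempty) (hk : (A c).card < 2) : ¬ AllJoin A act c := by
  obtain ⟨a, ha⟩ := hne
  intro hj
  have := hj a ha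
  rw [h a ha, clubStrategy_of_lt hk] at this
  exact this

theorem report_eq (hk : 2 ≤ (A c).card) {a : Fin κ} (ha : a ∈ A c) :
    (act (c, a)).report = u (c, a) := by
  rw [h a ha, clubStrategy_of_two_le hk]
  rfl

theorem existsUnique_bidder (hc : c ∈ C) (hne : (A c).Nonempty) :
    ∃! a, (c, a) ∈ bidders C A act := by
  rcases le_or_gt 2 (A c).card with hk | hk
  · exact existsUnique_bidder_of_allJoin hc hne (h.allJoin hk)
  · simp only [mem_bidders_of_not_allJoin hc (h.not_allJoin hne hk)
      fun a ha => by rw [h a ha]; exact clubStrategy_ne_abstain _ _]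
    have : (A c).card = 1 := by have := hne.card_pos; omega
    obtain ⟨a, ha⟩ := Finset.card_eq_one.1 this
    exact ⟨a, by simp [ha], by simp [ha]⟩

theorem card_bidders_eq_one (hc : c ∈ C) (hne : (A c).Nonempty) :
    (Finset.univ.filter fun a => (c, a) ∈ bidders C A act).card = 1 := by
  obtain ⟨a, ha, hu⟩ := h.existsUnique_bidder hc hne
  refine Finset.card_eq_one.2 ⟨a, ?_⟩
  ext a'
  simp only [Finset.mem_filter, Finset.mem_univ, true_and, Finset.mem_singleton]
  exact ⟨hu a', fun h' => h' ▸ ha⟩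

theorem le_of_mem_bidders {a : Fin κ} (ha : (c, a) ∈ bidders C A act) {a' : Fin κ}
    (ha' : a' ∈ A c) : u (c, a') ≤ u (c, a) := by
  have hac : a ∈ A c := (mem_bidders.1 ha).2.1
  rcases le_or_gt 2 (A c).card with hk | hk
  · have htop := (mem_bidders.1 ha).2.2
    rw [if_pos (h.allJoin hk)] at htop
    have h₁ := htop a' ha'
    simp only [h.report_eq hk ha', h.report_eq hk hac] at h₁
    rcases h₁ with h₁ | h₁
    · exact h₁.le
    · exact h₁.1.le
  · rw [Finset.card_le_one.1 (Nat.lt_succ_iff.1 hk) a' ha' a hac]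

theorem mainBid_eq {a : Fin κ} (ha : a ∈ A c) :
    mainBid F γ C A act (c, a) = bidStoch F (u (c, a)) (belief γ (announced C A act) 1) := by
  rcases le_or_gt 2 (A c).card with hk | hk
  · simp [mainBid, h a ha, clubStrategy_of_two_le hk, h.allJoin hk]
  · simp [mainBid, h a ha, clubStrategy_of_lt hk]

/-- The club payment tops the bid for P^{n,1} up to that for P^{n,k}. A non-member fits the same
formula with k = 1 and no payment, so members and non-members can be treated together. -/
theorem mainBid_add_clubPayment {a : Fin κ} (ha : a ∈ A c) :
    mainBid F γ C A act (c, a) + clubPayment F γ C A act (c, a) =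
      bidStoch F (u (c, a)) (belief γ (announced C A act) (A c).card) := by
  rw [h.mainBid_eq ha]
  rcases le_or_gt 2 (A c).card with hk | hk
  · simp [clubPayment, h a ha, clubStrategy_of_two_le hk, h.allJoin hk]
  · have : (A c).card = 1 := by have := Finset.card_pos.2 ⟨a, ha⟩; omega
    rw [this]
    simp [clubPayment, h a ha, clubStrategy_of_lt hk]

theorem mem_bidders_of_lt (hc : c ∈ C) {a : Fin κ} (ha : a ∈ A c)
    (hlt : ∀ a' ∈ A c, a' ≠ a → u (c, a') < u (c, a)) : (c, a) ∈ bidders C A act := by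
  refine mem_bidders.2 ⟨hc, ha, ?_⟩
  rcases le_or_gt 2 (A c).card with hk | hk
  · rw [if_pos (h.allJoin hk)]
    intro a' ha'
    simp only [h.report_eq hk ha', h.report_eq hk ha]
    by_cases he : a' = a
    · exact Or.inr ⟨by rw [he], he.ge⟩
    · exact Or.inl (hlt a' ha' he)
  · rw [if_neg (h.not_allJoin ⟨a, ha⟩ hk), h a ha]
    exact clubStrategy_ne_abstain _ _

end FollowsClub

theorem announced_eq_card {u : Agent κ → ℝ} (h : ∀ c ∈ C, FollowsClub F γ A act u c)
    (hne : ∀ c ∈ C, (A c).Nonempty) : announced C A act = C.card := by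
  rw [announced_eq_sum, Finset.sum_congr rfl fun c hc => (h c hc).card_bidders_eq_one hc (hne c hc)]
  simp

/-- Each compliant club contributes one bidder, while a club with a refusal has all its agents
registered. The refusal thus raises the announced number from |C| to |C| − 1 + k. -/
theorem announced_eq_card_add {u : Agent κ → ℝ} {c : ℕ} (hc : c ∈ C)
    (h : ∀ c' ∈ C, c' ≠ c → FollowsClub F γ A act u c') (hne : ∀ c ∈ C, (A c).Nonempty)
    (hj : ¬ AllJoin A act c) (hab : ∀ a ∈ A c, act (c, a) ≠ .abstain) :
    announced C A act = C.card - 1 + (A c).card := by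
  rw [announced_eq_sum, ← Finset.sum_erase_add _ _ hc]
  congr 1
  · rw [Finset.sum_congr rfl fun c' hc' =>
      (h c' (Finset.mem_of_mem_erase hc') (Finset.ne_of_mem_erase hc')).card_bidders_eq_one
        (Finset.mem_of_mem_erase hc') (hne c' (Finset.mem_of_mem_erase hc'))]
    simp [Finset.card_erase_of_mem hc]
  · simp [mem_bidders_of_not_allJoin hc hj hab]

/-- A winner outbids all agents of the other clubs. -/
theorem bidStoch_le_of_mem_winners {u : Agent κ → ℝ} {i : Agent κ}
    (hi : i ∈ winners F γ C A act)
    (hb : Monotone fun v => bidStoch F v (belief γ (announced C A act) 1))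
    {c : ℕ} (hc : c ∈ C) (h : FollowsClub F γ A act u c) {a : Fin κ} (ha : a ∈ A c) :
    bidStoch F (u (c, a)) (belief γ (announced C A act) 1) ≤ mainBid F γ C A act i := by
  obtain ⟨a', ha', -⟩ := h.existsUnique_bidder hc ⟨a, ha⟩
  refine (hb (h.le_of_mem_bidders ha' ha)).trans ?_
  simp only
  rw [← h.mainBid_eq (mem_bidders.1 ha').2.1]
  exact (mem_winners.1 hi).2 _ ha'

/-- The valuations of the other agents in the club of `i` are in `T`, and those of the agents in the
other clubs are in `S`. -/
def othersIn (C : Finset ℕ) (i : Agent κ) (T S : Set ℝ) :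
    Set ((ℕ → Finset (Fin κ)) × (Agent κ → ℝ)) :=
  {p | (∀ a ∈ p.1 i.1, a ≠ i.2 → p.2 (i.1, a) ∈ T) ∧
    ∀ c ∈ C, c ≠ i.1 → ∀ a ∈ p.1 c, p.2 (c, a) ∈ S}

theorem utility_of_notMem {v : ℝ} {i : Agent κ} (h : i ∉ winners F γ C A act) :
    utility F γ C A act v i = 0 := by simp [utility, h]

/-- Only the positive part is bounded: sharing a tie can only reduce it, and losing or winning at a
loss gives 0. So E need only contain the winning outcomes. -/
theorem ofReal_utility_le {v y : ℝ} {i : Agent κ} {α : Type*} {E : Set α} {p : α}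
    (hE : i ∈ winners F γ C A act → p ∈ E)
    (hy : i ∈ winners F γ C A act →
      mainBid F γ C A act i + clubPayment F γ C A act i = y) :
    ENNReal.ofReal (utility F γ C A act v i) ≤ E.indicator (fun _ => ENNReal.ofReal (v - y)) p := by
  by_cases h : i ∈ winners F γ C A act
  · rw [Set.indicator_of_mem (hE h)]
    have hpos : 1 ≤ (winners F γ C A act).card := Finset.card_pos.2 ⟨i, h⟩
    have : utility F γ C A act v i = (v - y) / (winners F γ C A act).card := by
      rw [utility, if_pos h, ← hy h, sub_sub]
    rw [this]
    rcases le_total 0 (v - y) with h₀ | h₀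
    · exact ENNReal.ofReal_le_ofReal (div_le_self h₀ (by exact_mod_cast hpos))
    · rw [ENNReal.ofReal_of_nonpos (div_nonpos_of_nonpos_of_nonneg h₀ (Nat.cast_nonneg _))]
      exact zero_le
  · rw [utility_of_notMem h, ENNReal.ofReal_zero]
    exact zero_le

end Outcomes

/-! ### Utility bounds when one agent deviates -/

section Deviations

variable {κ : ℕ} {μ : Measure ℝ} [IsProbabilityMeasure μ] [NullSingletonClass μ]
  {βA : PMF (Finset (Fin κ))} {C : Finset ℕ} {A : ℕ → Finset (Fin κ)}
  {w : Agent κ → ℝ} {i : Agent κ} {v : ℝ}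

/-- The actions if agent `i` takes the action `d` and the others follow the club strategy. -/
def deviationProfile (F : ℝ → ℝ) (γ : PMF ℕ) (A : ℕ → Finset (Fin κ)) (w : Agent κ → ℝ)
    (i : Agent κ) (d : Action) : Agent κ → Action :=
  Function.update (fun j => clubStrategy F γ (w j) (A j.1).card) i d

theorem deviationProfile_self (F : ℝ → ℝ) (γ : PMF ℕ) (d : Action) :
    deviationProfile F γ A w i d i = d := by simp [deviationProfile]

theorem deviationProfile_of_ne (F : ℝ → ℝ) (γ : PMF ℕ) (d : Action) {j : Agent κ} (h : j ≠ i) :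
    deviationProfile F γ A w i d j = clubStrategy F γ (w j) (A j.1).card := by
  simp [deviationProfile, h]

theorem followsClub_deviationProfile_of_ne (F : ℝ → ℝ) (γ : PMF ℕ) (d : Action) {c : ℕ}
    (h : c ≠ i.1) : FollowsClub F γ A (deviationProfile F γ A w i d) w c :=
  fun _ _ => deviationProfile_of_ne F γ d fun he => h (congrArg Prod.fst he)

/-- Reporting r is compliance by an agent whose valuation is r. All facts about compliant clubs
therefore also cover false reports. -/
theorem followsClub_deviationProfile (F : ℝ → ℝ) (γ : PMF ℕ) (r : ℝ) (c : ℕ) :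
    FollowsClub F γ A (deviationProfile F γ A w i (clubStrategy F γ r (A i.1).card))
      (Function.update w i r) c := by
  intro a _
  by_cases h : (c, a) = i
  · subst h
    simp [deviationProfile]
  · simp [deviationProfile, h]

theorem utility_abstain (F : ℝ → ℝ) (γ : PMF ℕ) (hi : i.2 ∈ A i.1) :
    utility F γ C A (deviationProfile F γ A w i .abstain) v i = 0 := by
  refine utility_of_notMem fun h => ?_
  have h₁ := (mem_bidders.1 (mem_winners.1 h).1).2.2
  have hj : ¬ AllJoin A (deviationProfile F γ A w i .abstain) i.1 := by
    intro hj
    have := hj i.2 hi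
    rw [deviationProfile_self] at this
    exact this
  rw [if_neg hj] at h₁
  exact h₁ (deviationProfile_self F γ _)

variable (hμ : μ (Set.Iio 0) = 0) (hA0 : (βA.map Finset.card) 0 = 0) (hC : 2 ≤ C.card)
  (hiC : i.1 ∈ C) (hi : i.2 ∈ A i.1) (hne : ∀ c ∈ C, (A c).Nonempty)
include hμ hA0 hC hiC hi hne

/-- A bound for the utility of an agent who registers on his own. -/
theorem ofReal_utility_direct_le (bid : ℕ → ℝ) {n k : ℕ} (hk : (A i.1).card = k)
    (hn : C.card - 1 + k = n) :
    ENNReal.ofReal (utility (cdf μ) (βA.map Finset.card) C A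
        (deviationProfile (cdf μ) (βA.map Finset.card) A w i (.direct bid)) v i) ≤
      (othersIn C i {x | bidStoch (cdf μ) x (belief (βA.map Finset.card) n k) ≤ bid n}
        {x | bidStoch (cdf μ) x (belief (βA.map Finset.card) n 1) ≤ bid n}).indicator
          (fun _ => ENNReal.ofReal (v - bid n)) (A, w) := by
  set F : ℝ → ℝ := ⇑(cdf μ)
  set γ := βA.map Finset.card
  set act := deviationProfile F γ A w i (.direct bid) with hact
  have hself : act i = .direct bid := deviationProfile_self F γ _
  have hk1 : 1 ≤ k := hk ▸ Finset.card_pos.2 ⟨i.2, hi⟩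
  have hother : ∀ c ∈ C, c ≠ i.1 → FollowsClub F γ A act w c := fun c _ h =>
    followsClub_deviationProfile_of_ne F γ _ h
  have hj : ¬ AllJoin A act i.1 := by
    intro hj
    have := hj i.2 hi
    rw [hself] at this
    exact this
  have hab : ∀ a ∈ A i.1, act (i.1, a) ≠ .abstain := by
    intro a _
    by_cases h : (i.1, a) = i
    · rw [h, hself]; simp
    · rw [hact, deviationProfile_of_ne F γ _ h]
      exact clubStrategy_ne_abstain _ _
  have hann : announced C A act = n := by
    rw [announced_eq_card_add hiC hother hne hj hab, hk, hn]
  have hmain : mainBid F γ C A act i = bid n := by simp [mainBid, hself, hann]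
  refine ofReal_utility_le (fun hwin => ⟨fun a ha hai => ?_, fun c hc hci a ha => ?_⟩) fun _ => ?_
  · have hne' : (i.1, a) ≠ i := fun h => hai (congrArg Prod.snd h)
    -- The mere existence of a clubmate makes him an invited agent; he accepted, so the coordinator
    -- bids for him according to P^{n,k}.
    have hk2 : 2 ≤ (A i.1).card := Finset.one_lt_card.2 ⟨a, ha, i.2, hi, hai⟩
    have h₁ := (mem_winners.1 hwin).2 _ ((mem_bidders_of_not_allJoin hiC hj hab).2 ha)
    have h₂ : act (i.1, a) = .join (w (i.1, a)) := by
      rw [hact, deviationProfile_of_ne F γ _ hne', clubStrategy_of_two_le hk2]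
    have h₃ : mainBid F γ C A act (i.1, a) = bidStoch F (w (i.1, a)) (belief γ n k) := by
      simp [mainBid, h₂, hj, hann, hk]
    rw [hmain, h₃] at h₁
    exact h₁
  · have hb := (isBidderLaw_belief hA0 (show 2 ≤ n by omega) le_rfl).bidStoch_mono hμ
    have h₁ := bidStoch_le_of_mem_winners hwin (hann ▸ hb) hc (hother c hc hci) ha
    rw [hann, hmain] at h₁
    exact h₁
  · simp [hmain, clubPayment, hself]

omit hiC in
/-- A bound for the utility of a club member who reports `r`. -/
theorem ofReal_utility_report_le (r : ℝ) {k : ℕ} (hk : (A i.1).card = k) :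
    ENNReal.ofReal (utility (cdf μ) (βA.map Finset.card) C A
        (deviationProfile (cdf μ) (βA.map Finset.card) A w i
          (clubStrategy (cdf μ) (βA.map Finset.card) r k)) v i) ≤
      (othersIn C i {x | cdf μ x ≤ cdf μ r} {x | cdf μ x ≤ cdf μ r}).indicator
        (fun _ => ENNReal.ofReal
          (v - bidStoch (cdf μ) r (belief (βA.map Finset.card) C.card k))) (A, w) := by
  subst hk
  set F : ℝ → ℝ := ⇑(cdf μ)
  set γ := βA.map Finset.card
  set act := deviationProfile F γ A w i (clubStrategy F γ r (A i.1).card)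
  set u := Function.update w i r
  have hf : ∀ c, FollowsClub F γ A act u c := followsClub_deviationProfile F γ r
  have hann : announced C A act = C.card := announced_eq_card (fun c _ => hf c) hne
  have hP := isBidderLaw_belief hA0 hC le_rfl
  have hui : u i = r := Function.update_self ..
  refine ofReal_utility_le (fun hwin => ⟨fun a ha hai => ?_, fun c hc hci a ha => ?_⟩) fun _ => ?_
  · have h₁ := (hf i.1).le_of_mem_bidders (mem_winners.1 hwin).1 ha
    have hne' : (i.1, a) ≠ i := fun h => hai (congrArg Prod.snd h)
    have h₂ : u (i.1, a) = w (i.1, a) := Function.update_of_ne hne' ..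
    rw [h₂, Prod.mk.eta, hui] at h₁
    exact monotone_cdf μ h₁
  · have h₁ := bidStoch_le_of_mem_winners hwin (hann ▸ hP.bidStoch_mono hμ) hc (hf c) ha
    have hne' : (c, a) ≠ i := fun h => hci (congrArg Prod.fst h)
    have h₂ : u (c, a) = w (c, a) := Function.update_of_ne hne' ..
    have h₃ := (hf i.1).mainBid_eq (C := C) hi
    rw [Prod.mk.eta] at h₃
    rw [h₃, hui, h₂, hann] at h₁
    by_contra h
    exact absurd h₁ (not_le.2 (hP.bidStoch_lt hμ (not_le.1 h)))
  · have h₁ := (hf i.1).mainBid_add_clubPayment (C := C) hi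
    rwa [Prod.mk.eta, hui, hann] at h₁

-- Makes the negative part of the equilibrium utility vanish, so that positive parts suffice for
-- comparing expectations.
omit hiC in
theorem utility_truthful_nonneg (hv : 0 ≤ v) {k : ℕ} (hk : (A i.1).card = k) :
    0 ≤ utility (cdf μ) (βA.map Finset.card) C A
      (deviationProfile (cdf μ) (βA.map Finset.card) A w i
        (clubStrategy (cdf μ) (βA.map Finset.card) v k)) v i := by
  subst hk
  have hf := followsClub_deviationProfile (A := A) (w := w) (i := i) (cdf μ)
    (βA.map Finset.card) v
  have h₁ := (hf i.1).mainBid_add_clubPayment (C := C) hi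
  rw [Prod.mk.eta, announced_eq_card (fun c _ => hf c) hne, Function.update_self] at h₁
  unfold utility
  split_ifs
  · rw [sub_sub, h₁]
    have hP := isBidderLaw_belief hA0 hC (Finset.card_pos.2 ⟨i.2, hi⟩)
    exact div_nonneg (sub_nonneg.2 (hP.bidStoch_le hμ hv)) (Nat.cast_nonneg _)
  · exact le_rfl

/-- A truthful agent whose valuation exceeds all others wins and pays `b^e(v, P^{n,k})`. -/
theorem le_ofReal_utility_truthful {k : ℕ} (hk : (A i.1).card = k) :
    (othersIn C i {x | cdf μ x < cdf μ v} {x | cdf μ x < cdf μ v}).indicator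
        (fun _ => ENNReal.ofReal
          (v - bidStoch (cdf μ) v (belief (βA.map Finset.card) C.card k))) (A, w) ≤
      ENNReal.ofReal (utility (cdf μ) (βA.map Finset.card) C A
        (deviationProfile (cdf μ) (βA.map Finset.card) A w i
          (clubStrategy (cdf μ) (βA.map Finset.card) v k)) v i) := by
  subst hk
  by_cases hE : (A, w) ∈ othersIn C i {x | cdf μ x < cdf μ v} {x | cdf μ x < cdf μ v}
  swap
  · rw [Set.indicator_of_notMem hE]
    exact zero_le
  rw [Set.indicator_of_mem hE]
  set F : ℝ → ℝ := ⇑(cdf μ)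
  set γ := βA.map Finset.card
  set act := deviationProfile F γ A w i (clubStrategy F γ v (A i.1).card)
  set u := Function.update w i v
  have hf : ∀ c, FollowsClub F γ A act u c := followsClub_deviationProfile F γ v
  have hann : announced C A act = C.card := announced_eq_card (fun c _ => hf c) hne
  have hP := isBidderLaw_belief hA0 hC le_rfl
  have hui : u i = v := Function.update_self ..
  have hmain := (hf i.1).mainBid_eq (C := C) hi
  have hpay := (hf i.1).mainBid_add_clubPayment (C := C) hi
  rw [Prod.mk.eta, hui, hann] at hmain hpay
  have hbid : i ∈ bidders C A act := by
    refine (hf i.1).mem_bidders_of_lt hiC hi fun a ha hai => ?_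
    have hne' : (i.1, a) ≠ i := fun h => hai (congrArg Prod.snd h)
    have h₂ : u (i.1, a) = w (i.1, a) := Function.update_of_ne hne' ..
    rw [Prod.mk.eta, hui, h₂]
    by_contra! h
    exact absurd (monotone_cdf μ h) (not_le.2 (hE.1 a ha hai))
  -- Strictly lower F gives strictly lower bids, so there is no tie and the full margin is earned.
  have hlt : ∀ j ∈ bidders C A act, j ≠ i →
      mainBid F γ C A act j < mainBid F γ C A act i := by
    rintro ⟨c, a⟩ hj hji
    obtain ⟨hc, ha, -⟩ := mem_bidders.1 hj
    by_cases hci : c = i.1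
    · subst hci
      have he : a = i.2 := ((hf i.1).existsUnique_bidder hiC ⟨i.2, hi⟩).unique hj hbid
      exact absurd (by rw [he]) hji
    · have h₂ : u (c, a) = w (c, a) := Function.update_of_ne hji ..
      rw [hmain, (hf c).mainBid_eq ha, hann, h₂]
      exact hP.bidStoch_lt hμ (hE.2 c hc hci a ha)
  have hwin : winners F γ C A act = {i} := by
    ext j
    rw [mem_winners, Finset.mem_singleton]
    constructor
    · rintro ⟨hj, hmax⟩
      by_contra hji
      exact absurd (hmax i hbid) (not_le.2 (hlt j hj hji))
    · rintro rfl
      refine ⟨hbid, fun l hl => ?_⟩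
      by_cases hlj : l = j
      · rw [hlj]
      · exact (hlt l hl hlj).le
  have : utility F γ C A act v i = v - bidStoch F v (belief γ C.card (A i.1).card) := by
    rw [utility, if_pos (by simp [hwin]), hwin, sub_sub, hpay]
    simp
  rw [this]

end Deviations

/-! ### Probabilities of outcomes -/

section Probabilities

variable {κ : ℕ} (βA : PMF (Finset (Fin κ))) (μ : Measure ℝ) [IsProbabilityMeasure μ]

/-- The law of the sets of agents and of the valuations. -/
def agentsLaw : Measure ((ℕ → Finset (Fin κ)) × (Agent κ → ℝ)) :=
  (Measure.infinitePi fun _ : ℕ => βA.toMeasure).prod (Measure.infinitePi fun _ : Agent κ => μ)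

instance : IsProbabilityMeasure (agentsLaw βA μ) := by
  unfold agentsLaw
  infer_instance

/-- Agent `i` is present in his club, which has `k` agents. -/
def presentIn (i : Agent κ) (k : ℕ) : Set ((ℕ → Finset (Fin κ)) × (Agent κ → ℝ)) :=
  {p | i.2 ∈ p.1 i.1 ∧ (p.1 i.1).card = k}

theorem measurableSet_presentIn (i : Agent κ) (k : ℕ) : MeasurableSet (presentIn i k) := by
  have h : Measurable fun p : (ℕ → Finset (Fin κ)) × (Agent κ → ℝ) => p.1 i.1 := by fun_prop
  exact h (MeasurableSet.of_discrete (s := {B : Finset (Fin κ) | i.2 ∈ B ∧ B.card = k}))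

theorem measurableSet_othersIn (C : Finset ℕ) (i : Agent κ) {T S : Set ℝ} (hT : MeasurableSet T)
    (hS : MeasurableSet S) : MeasurableSet (othersIn C i T S) := by
  have h₁ : ∀ c (a : Fin κ), Measurable fun p : (ℕ → Finset (Fin κ)) × (Agent κ → ℝ) =>
      a ∈ p.1 c := by
    intro c a
    have h : Measurable fun p : (ℕ → Finset (Fin κ)) × (Agent κ → ℝ) => p.1 c := by fun_prop
    exact measurableSet_setOfPred.1
      (h (MeasurableSet.of_discrete (s := {B : Finset (Fin κ) | a ∈ B})))
  have h₂ : ∀ (j : Agent κ) {S : Set ℝ}, MeasurableSet S →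
      Measurable fun p : (ℕ → Finset (Fin κ)) × (Agent κ → ℝ) => p.2 j ∈ S := by
    intro j S hS
    have h : Measurable fun p : (ℕ → Finset (Fin κ)) × (Agent κ → ℝ) => p.2 j := by fun_prop
    exact measurableSet_setOfPred.1 (h hS)
  refine measurableSet_setOfPred.2 (Measurable.and ?_ ?_)
  · exact Measurable.forall fun a => (h₁ _ a).imp (measurable_const.imp (h₂ _ hT))
  · exact Measurable.forall fun c => measurable_const.imp (measurable_const.imp
      (Measurable.forall fun a => (h₁ c a).imp (h₂ _ hS)))

theorem infinitePi_othersIn (C : Finset ℕ) {i : Agent κ} (hi : i.1 ∈ C) {T S : Set ℝ}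
    (hT : MeasurableSet T) (hS : MeasurableSet S) {A : ℕ → Finset (Fin κ)} (hA : i.2 ∈ A i.1) :
    (Measure.infinitePi fun _ : Agent κ => μ) {w | (A, w) ∈ othersIn C i T S} =
      μ T ^ ((A i.1).card - 1) * ∏ c ∈ C.erase i.1, μ S ^ (A c).card := by
  -- With `i` removed from his own club, the agents of the clubs in `C` are exactly the rivals, and
  -- the event is a finite cylinder. This gives the exponent |A_{i.1}| − 1.
  let A' : ℕ → Finset (Fin κ) := Function.update A i.1 ((A i.1).erase i.2)
  have hself : A' i.1 = (A i.1).erase i.2 := Function.update_self ..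
  have hother : ∀ c, c ≠ i.1 → A' c = A c := fun c hc => Function.update_of_ne hc ..
  have hset : {w | (A, w) ∈ othersIn C i T S} =
      ((C.sigma A').map (Equiv.sigmaEquivProd ℕ (Fin κ)).toEmbedding :
        Set (Agent κ)).pi fun j => if j.1 = i.1 then T else S := by
    ext w
    simp only [othersIn, Set.mem_pi, Set.mem_ofPred_eq, Finset.mem_coe, Finset.mem_map]
    constructor
    · rintro ⟨h₁, h₂⟩ j ⟨⟨c, a⟩, hj, rfl⟩
      obtain ⟨hc, ha⟩ := Finset.mem_sigma.1 hj
      by_cases hci : c = i.1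
      · subst hci
        simp only [hself, Finset.mem_erase] at ha
        simpa using! h₁ a ha.2 ha.1
      · simp only [hother c hci] at ha
        simpa [hci] using! h₂ c hc hci a ha
    · intro h
      refine ⟨fun a ha hai => ?_, fun c hc hci a ha => ?_⟩
      · simpa using! h (i.1, a) ⟨⟨i.1, a⟩, by simp [hself, hi, ha, hai], rfl⟩
      · simpa [hci] using! h (c, a) ⟨⟨c, a⟩, by simp [hc, ha, hother c hci], rfl⟩
  rw [hset, Measure.infinitePi_pi]
  · rw [Finset.prod_map, Finset.prod_sigma, ← Finset.mul_prod_erase C _ hi]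
    congr 1
    · simp [hself, Finset.card_erase_of_mem hA]
    · refine Finset.prod_congr rfl fun c hc => ?_
      have hci := Finset.ne_of_mem_erase hc
      simp [hother c hci, hci]
  · intro j _
    split_ifs
    · exact hT
    · exact hS

theorem lintegral_infinitePi_prod (C : Finset ℕ) (g : ℕ → Finset (Fin κ) → ℝ≥0∞) :
    ∫⁻ A, ∏ c ∈ C, g c (A c) ∂(Measure.infinitePi fun _ : ℕ => βA.toMeasure) =
      ∏ c ∈ C, ∑ B, βA B * g c B := by
  have hind : iIndepFun (fun (c : ℕ) (A : ℕ → Finset (Fin κ)) => g c (A c))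
      (Measure.infinitePi fun _ : ℕ => βA.toMeasure) :=
    iIndepFun_infinitePi (X := fun c B => g c B) fun c => Measurable.of_discrete
  rw [lintegral_prod_eq_prod_lintegral_of_indepFun C _ hind
    fun c => Measurable.of_discrete.comp (measurable_pi_apply c)]
  refine Finset.prod_congr rfl fun c _ => ?_
  rw [(measurePreserving_eval_infinitePi (fun _ : ℕ => βA.toMeasure) c).lintegral_comp
    (f := g c) Measurable.of_discrete, lintegral_fintype]
  refine Finset.sum_congr rfl fun B _ => ?_
  rw [PMF.toMeasure_apply_singleton _ _ (measurableSet_singleton B), mul_comm]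

/-- The probability that `i` is present in a club with `k` agents. -/
def presentProb (i : Agent κ) (k : ℕ) : ℝ≥0∞ :=
  ∑ B, βA B * if i.2 ∈ B ∧ B.card = k then 1 else 0

theorem agentsLaw_presentIn_inter (C : Finset ℕ) {i : Agent κ} (hi : i.1 ∈ C) (k : ℕ)
    {T S : Set ℝ} (hT : MeasurableSet T) (hS : MeasurableSet S) :
    agentsLaw βA μ (presentIn i k ∩ othersIn C i T S) =
      presentProb βA i k * (μ T ^ (k - 1) * clubWeightENN βA (μ S) ^ (C.card - 1)) := by
  rw [agentsLaw, Measure.prod_apply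
    ((measurableSet_presentIn i k).inter (measurableSet_othersIn C i hT hS))]
  -- For fixed club compositions the probability is a product over clubs; the factor of the own club
  -- absorbs the presence condition, so independence across clubs can be used.
  let g : ℕ → Finset (Fin κ) → ℝ≥0∞ := fun c B =>
    if c = i.1 then (if i.2 ∈ B ∧ B.card = k then 1 else 0) * μ T ^ (k - 1) else μ S ^ B.card
  have h₁ : ∀ A : ℕ → Finset (Fin κ), (Measure.infinitePi fun _ : Agent κ => μ)
      (Prod.mk A ⁻¹' (presentIn i k ∩ othersIn C i T S)) = ∏ c ∈ C, g c (A c) := by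
    intro A
    rw [← Finset.mul_prod_erase C _ hi]
    have h₂ : ∏ c ∈ C.erase i.1, g c (A c) = ∏ c ∈ C.erase i.1, μ S ^ (A c).card :=
      Finset.prod_congr rfl fun c hc => by simp [g, Finset.ne_of_mem_erase hc]
    rw [h₂]
    by_cases h : i.2 ∈ A i.1 ∧ (A i.1).card = k
    · have h₃ : Prod.mk A ⁻¹' (presentIn i k ∩ othersIn C i T S) =
          {w | (A, w) ∈ othersIn C i T S} := by
        ext w
        exact ⟨fun hw => hw.2, fun hw => ⟨h, hw⟩⟩
      rw [h₃, infinitePi_othersIn μ C hi hT hS h.1]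
      simp [g, h.1, h.2]
    · have h₃ : Prod.mk A ⁻¹' (presentIn i k ∩ othersIn C i T S) = ∅ := by
        ext w
        exact ⟨fun hw => h hw.1, fun hw => hw.elim⟩
      rw [h₃, measure_empty]
      simp [g, h]
  simp only [h₁]
  rw [lintegral_infinitePi_prod, ← Finset.mul_prod_erase C _ hi]
  have h₂ : ∏ c ∈ C.erase i.1, ∑ B, βA B * g c B = clubWeightENN βA (μ S) ^ (C.card - 1) := by
    rw [Finset.prod_congr rfl (g := fun _ => clubWeightENN βA (μ S)), Finset.prod_const,
      Finset.card_erase_of_mem hi]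
    intro c hc
    simp [g, Finset.ne_of_mem_erase hc, clubWeightENN]
  rw [h₂, presentProb, ← mul_assoc]
  congr 1
  rw [Finset.sum_mul]
  exact Finset.sum_congr rfl fun B _ => by simp [g]

variable (βC : PMF (Finset ℕ))

theorem measurableSet_selected (i : Agent κ) (k : ℕ) :
    MeasurableSet (selected i k : Set (State κ)) := by
  have h₁ : MeasurableSet {ω : State κ | i.1 ∈ ω.1} :=
    measurable_fst (MeasurableSet.of_discrete (s := {C : Finset ℕ | i.1 ∈ C}))
  exact h₁.inter (measurable_snd (measurableSet_presentIn i k))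

/-- The events and the gain may depend on C, as the announced number does; the integral then splits
into a countable sum over C. -/
theorem setLIntegral_selected (i : Agent κ) (k : ℕ) {T S : Finset ℕ → Set ℝ}
    (hT : ∀ C, MeasurableSet (T C)) (hS : ∀ C, MeasurableSet (S C)) (a : Finset ℕ → ℝ≥0∞) :
    ∫⁻ ω in selected i k, (othersIn ω.1 i (T ω.1) (S ω.1)).indicator (fun _ => a ω.1) ω.2
        ∂(prior βC βA μ) =
      ∑' C, (if i.1 ∈ C then a C * (presentProb βA i k *
        (μ (T C) ^ (k - 1) * clubWeightENN βA (μ (S C)) ^ (C.card - 1))) else 0) * βC C := by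
  classical
  rw [← lintegral_indicator (measurableSet_selected i k)]
  have hpt : ∀ C p, (selected i k).indicator (fun ω : State κ =>
      (othersIn ω.1 i (T ω.1) (S ω.1)).indicator (fun _ => a ω.1) ω.2) (C, p) =
      (if i.1 ∈ C then presentIn i k ∩ othersIn C i (T C) (S C) else ∅).indicator
        (fun _ => a C) p := by
    intro C p
    by_cases hC : i.1 ∈ C
    · rw [if_pos hC, Set.inter_comm, ← Set.indicator_indicator, Set.indicator_indicator,
        Set.inter_comm, ← Set.indicator_indicator]
      by_cases hp : p ∈ presentIn i k
      · rw [Set.indicator_of_mem hp, Set.indicator_of_mem (s := selected i k)]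
        exact ⟨hC, hp⟩
      · rw [Set.indicator_of_notMem hp, Set.indicator_of_notMem (s := selected i k)]
        exact fun h => hp h.2
    · rw [if_neg hC, Set.indicator_empty, Set.indicator_of_notMem]
      exact fun h => hC h.1
  have hmeas : ∀ C, MeasurableSet
      (if i.1 ∈ C then presentIn i k ∩ othersIn C i (T C) (S C) else ∅) := by
    intro C
    split_ifs
    · exact (measurableSet_presentIn i k).inter (measurableSet_othersIn C i (hT C) (hS C))
    · exact MeasurableSet.empty
  change ∫⁻ ω, _ ∂(βC.toMeasure.prod (agentsLaw βA μ)) = _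
  rw [lintegral_prod]
  · simp only [hpt]
    rw [lintegral_countable']
    refine tsum_congr fun C => ?_
    rw [lintegral_indicator_const (hmeas C),
      PMF.toMeasure_apply_singleton _ _ (measurableSet_singleton C)]
    split_ifs with hC
    · rw [agentsLaw_presentIn_inter βA μ C hC k (hT C) (hS C)]
    · simp
  · refine (measurable_from_prod_countable_right fun C => ?_).aemeasurable
    simp only [hpt]
    exact measurable_const.indicator (hmeas C)

variable {βA βC}

theorem two_le_card_of_ne_zero (hC0 : (βC.map Finset.card) 0 = 0)
    (hC1 : (βC.map Finset.card) 1 = 0) {C : Finset ℕ} (hC : βC C ≠ 0) : 2 ≤ C.card := by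
  have h : C.card ∈ (βC.map Finset.card).support :=
    (PMF.mem_support_map_iff _ _ _).2 ⟨C, (PMF.mem_support_iff _ _).2 hC, rfl⟩
  rw [PMF.mem_support_iff] at h
  by_contra! hlt
  interval_cases hcard : C.card
  · exact h hC0
  · exact h hC1

theorem ae_prior_two_le_card (hC0 : (βC.map Finset.card) 0 = 0)
    (hC1 : (βC.map Finset.card) 1 = 0) : ∀ᵐ ω ∂(prior βC βA μ), 2 ≤ ω.1.card := by
  have h : ∀ᵐ C ∂βC.toMeasure, 2 ≤ C.card := by
    rw [ae_iff_of_countable]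
    intro C hC
    rw [PMF.toMeasure_apply_singleton _ _ (measurableSet_singleton C)] at hC
    exact two_le_card_of_ne_zero hC0 hC1 hC
  exact Measure.quasiMeasurePreserving_fst.ae h

theorem ae_prior_nonempty (hA0 : (βA.map Finset.card) 0 = 0) :
    ∀ᵐ ω ∂(prior βC βA μ), ∀ c, (ω.2.1 c).Nonempty := by
  have h : ∀ᵐ B ∂βA.toMeasure, B.Nonempty := by
    rw [ae_iff_of_countable]
    intro B hB
    rw [PMF.toMeasure_apply_singleton _ _ (measurableSet_singleton B)] at hB
    exact Finset.card_pos.1 (card_pos_of_mem_support hA0 ((PMF.mem_support_iff _ _).2 hB))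
  have h₁ : ∀ᵐ A ∂(Measure.infinitePi fun _ : ℕ => βA.toMeasure), ∀ c, (A c).Nonempty :=
    ae_all_iff.2 fun c => (measurePreserving_eval_infinitePi
      (fun _ : ℕ => βA.toMeasure) c).quasiMeasurePreserving.ae h
  exact Measure.quasiMeasurePreserving_snd.ae (Measure.quasiMeasurePreserving_fst.ae h₁)

end Probabilities

/-! ### The equilibrium of the bidding-club game -/

section Equilibrium

variable {κ : ℕ} {βC : PMF (Finset ℕ)} {βA : PMF (Finset (Fin κ))} {μ : Measure ℝ}
  [IsProbabilityMeasure μ]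

theorem clubWeightENN_mono {s t : ℝ≥0∞} (h : s ≤ t) : clubWeightENN βA s ≤ clubWeightENN βA t := by
  unfold clubWeightENN
  gcongr

theorem ofReal_topWeight_belief (hA0 : (βA.map Finset.card) 0 = 0) {n k : ℕ} (hn : 2 ≤ n)
    (hk : 1 ≤ k) (L : Set ℝ) :
    ENNReal.ofReal (topWeight (belief (βA.map Finset.card) n k) (μ.real L)) =
      μ L ^ (k - 1) * clubWeightENN βA (μ L) ^ (n - 1) := by
  have h₀ : 0 ≤ μ.real L := measureReal_nonneg
  have h : μ L = ENNReal.ofReal (μ.real L) := (ofReal_measureReal (measure_ne_top μ L)).symm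
  rw [topWeight_belief hA0 hn hk h₀, h, ENNReal.ofReal_mul (by positivity), ENNReal.ofReal_pow h₀,
    ENNReal.ofReal_pow (clubWeight_nonneg βA h₀), clubWeightENN_ofReal βA h₀]

/-- The probability-weighted gain of a deviation that pays `y` and wins only if the other agents are
in `T` and `S`. -/
theorem ofReal_mul_le_of_subset (hA0 : (βA.map Finset.card) 0 = 0) {n k : ℕ} (hn : 2 ≤ n)
    (hk : 1 ≤ k) {T S L : Set ℝ} (hT : T ⊆ L) (hS : S ⊆ L) {v y W : ℝ}
    (hW : topWeight (belief (βA.map Finset.card) n k) (μ.real L) * (v - y) ≤ W) :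
    ENNReal.ofReal (v - y) * (μ T ^ (k - 1) * clubWeightENN βA (μ S) ^ (n - 1)) ≤
      ENNReal.ofReal W := by
  have hw := (isBidderLaw_belief hA0 hn hk).topWeight_nonneg
    (measureReal_nonneg (μ := μ) (s := L))
  calc _ ≤ ENNReal.ofReal (v - y) * (μ L ^ (k - 1) * clubWeightENN βA (μ L) ^ (n - 1)) := by
        gcongr
        exact clubWeightENN_mono (measure_mono hS)
    _ = ENNReal.ofReal (topWeight (belief (βA.map Finset.card) n k) (μ.real L) * (v - y)) := by
        rw [← ofReal_topWeight_belief hA0 hn hk, ENNReal.ofReal_mul hw, mul_comm]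
    _ ≤ _ := ENNReal.ofReal_le_ofReal hW

theorem clubStrategy_feasible (F : ℝ → ℝ) (γ : PMF ℕ) : (clubStrategy F γ).Feasible := by
  intro v k h
  by_contra hk
  rw [clubStrategy_of_lt (not_le.1 hk)] at h
  exact h

/-- Losses only lower the expectation of `f`, so they can be discarded, and no integrability of a
deviator's utility is needed. -/
theorem expectation_le_of_lintegral_le {Ω : Type} [MeasurableSpace Ω] {P : Measure Ω} {f g : Ω → ℝ}
    (hfg : ∫⁻ ω, ENNReal.ofReal (f ω) ∂P ≤ ∫⁻ ω, ENNReal.ofReal (g ω) ∂P)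
    (hg : ∀ᵐ ω ∂P, 0 ≤ g ω) : expectation P f ≤ expectation P g := by
  unfold expectation
  have h₀ : ∫⁻ ω, ENNReal.ofReal (-g ω) ∂P = 0 := by
    rw [lintegral_congr_ae (g := fun _ => 0)]
    · simp
    · filter_upwards [hg] with ω hω
      exact ENNReal.ofReal_of_nonpos (neg_nonpos.2 hω)
  rw [h₀]
  refine EReal.sub_le_sub (by exact_mod_cast hfg) ?_
  exact_mod_cast zero_le

variable [NullSingletonClass μ]

theorem isBayesNash_clubStrategy (hC0 : (βC.map Finset.card) 0 = 0)
    (hC1 : (βC.map Finset.card) 1 = 0) (hA0 : (βA.map Finset.card) 0 = 0)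
    (hμ : μ (Set.Iio 0) = 0) :
    IsBayesNash βC βA μ fun _ => clubStrategy (cdf μ) (βA.map Finset.card) := by
  refine ⟨fun _ => clubStrategy_feasible _ _, fun i v k hv s hs => ?_⟩
  have hsel := measurableSet_selected (κ := κ) i k
  rcases Nat.eq_zero_or_pos k with hk0 | hk
  · have : (selected i k : Set (State κ)) = ∅ := by
      subst hk0
      ext ω
      refine ⟨fun h => ?_, fun h => h.elim⟩
      have h₁ := Finset.card_eq_zero.1 h.2.2
      have h₂ := h.2.1
      rw [h₁] at h₂
      exact absurd h₂ (Finset.notMem_empty _)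
    simp [interimUtility, this, expectation]
  set F : ℝ → ℝ := ⇑(cdf μ)
  set γ := βA.map Finset.card
  let u : Action → State κ → ℝ := fun d ω =>
    utility F γ ω.1 ω.2.1 (deviationProfile F γ ω.2.1 ω.2.2 i d) v i
  have hgood : ∀ᵐ ω ∂(prior βC βA μ).restrict (selected i k),
      ω ∈ selected i k ∧ 2 ≤ ω.1.card ∧ ∀ c, (ω.2.1 c).Nonempty := by
    filter_upwards [ae_restrict_mem hsel, ae_restrict_of_ae (ae_prior_two_le_card μ hC0 hC1),
      ae_restrict_of_ae (ae_prior_nonempty μ hA0)] with ω h₁ h₂ h₃ using ⟨h₁, h₂, h₃⟩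
  have key : ∫⁻ ω in selected i k, ENNReal.ofReal (u (s v k) ω) ∂(prior βC βA μ) ≤
      ∫⁻ ω in selected i k, ENNReal.ofReal (u (clubStrategy F γ v k) ω) ∂(prior βC βA μ) := by
    -- The equilibrium payoff of the ordinary auction with law P^{|C|,k}: the common benchmark,
    -- reached by truthfulness and exceeded by no deviation.
    let W : Finset ℕ → ℝ := fun C =>
      topWeight (belief γ C.card k) (F v) * (v - bidStoch F v (belief γ C.card k))
    have hlower : ∑' C, (if i.1 ∈ C then
        presentProb βA i k * ENNReal.ofReal (W C) else 0) * βC C ≤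
        ∫⁻ ω in selected i k, ENNReal.ofReal (u (clubStrategy F γ v k) ω) ∂(prior βC βA μ) := by
      have hms : MeasurableSet {x | F x < F v} :=
        measurableSet_lt (monotone_cdf μ).measurable measurable_const
      calc _ = ∑' C, (if i.1 ∈ C then
              ENNReal.ofReal (v - bidStoch F v (belief γ C.card k)) * (presentProb βA i k *
                (μ {x | F x < F v} ^ (k - 1) *
                  clubWeightENN βA (μ {x | F x < F v}) ^ (C.card - 1))) else 0) * βC C := by
            refine tsum_congr fun C => ?_
            by_cases hC : βC C = 0
            · simp [hC]
            have hn := two_le_card_of_ne_zero hC0 hC1 hC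
            have hP := isBidderLaw_belief hA0 hn hk
            rw [← ofReal_topWeight_belief hA0 hn hk, measureReal_cdf_lt,
              ENNReal.ofReal_mul (hP.topWeight_nonneg (cdf_nonneg μ v))]
            congr 2
            ring
        _ = _ := (setLIntegral_selected βA μ βC i k (fun _ => hms) (fun _ => hms) _).symm
        _ ≤ _ := by
            refine lintegral_mono_ae ?_
            filter_upwards [hgood] with ω ⟨h₁, h₂, h₃⟩
            exact le_ofReal_utility_truthful hμ hA0 h₂ h₁.1 h₁.2.1 (fun c _ => h₃ c) h₁.2.2
    have hupper : ∀ (d : Action) (T S : Finset ℕ → Set ℝ) (y : Finset ℕ → ℝ)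
        (L : Finset ℕ → Set ℝ), (∀ C, MeasurableSet (T C)) → (∀ C, MeasurableSet (S C)) →
        (∀ C, 2 ≤ C.card → T C ⊆ L C ∧ S C ⊆ L C ∧
          topWeight (belief γ C.card k) (μ.real (L C)) * (v - y C) ≤ W C) →
        (∀ ω : State κ, ω ∈ selected i k → 2 ≤ ω.1.card → (∀ c, (ω.2.1 c).Nonempty) →
          ENNReal.ofReal (u d ω) ≤ (othersIn ω.1 i (T ω.1) (S ω.1)).indicator
            (fun _ => ENNReal.ofReal (v - y ω.1)) ω.2) →
        ∫⁻ ω in selected i k, ENNReal.ofReal (u d ω) ∂(prior βC βA μ) ≤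
          ∑' C, (if i.1 ∈ C then presentProb βA i k * ENNReal.ofReal (W C) else 0) * βC C := by
      intro d T S y L hT hS hL hd
      calc _ ≤ ∫⁻ ω in selected i k, (othersIn ω.1 i (T ω.1) (S ω.1)).indicator
            (fun _ => ENNReal.ofReal (v - y ω.1)) ω.2 ∂(prior βC βA μ) := by
            refine lintegral_mono_ae ?_
            filter_upwards [hgood] with ω ⟨h₁, h₂, h₃⟩ using hd ω h₁ h₂ h₃
        _ = _ := setLIntegral_selected βA μ βC i k hT hS fun C => ENNReal.ofReal (v - y C)
        _ ≤ _ := by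
            refine ENNReal.tsum_le_tsum fun C => ?_
            by_cases hC : βC C = 0
            · simp [hC]
            have hn := two_le_card_of_ne_zero hC0 hC1 hC
            obtain ⟨h₁, h₂, h₃⟩ := hL C hn
            refine mul_le_mul_left ?_ _
            split_ifs
            · rw [mul_left_comm]
              exact mul_le_mul_right (ofReal_mul_le_of_subset hA0 hn hk h₁ h₂ h₃) _
            · exact le_rfl
    refine le_trans ?_ hlower
    have hmeas : ∀ {n l : ℕ}, 2 ≤ n → 1 ≤ l → ∀ x : ℝ,
        MeasurableSet {z | bidStoch F z (belief γ n l) ≤ x} := fun hn hl x =>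
      measurableSet_le ((isBidderLaw_belief hA0 hn hl).bidStoch_mono hμ).measurable measurable_const
    cases hact : s v k with
    | abstain =>
      refine (lintegral_mono_ae (g := fun _ => 0) ?_).trans (by simp)
      filter_upwards [hgood] with ω ⟨h₁, h₂, h₃⟩
      simp [u, utility_abstain F γ h₁.2.1]
    | direct bid =>
      refine hupper _
        -- Monotone, hence measurable, bids are available only for at least two bidders; the value ∅
        -- covers the remaining C, which have probability zero.
        (fun C => if 2 ≤ C.card then
          {x | bidStoch F x (belief γ (C.card - 1 + k) k) ≤ bid (C.card - 1 + k)} else ∅)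
        (fun C => if 2 ≤ C.card then
          {x | bidStoch F x (belief γ (C.card - 1 + k) 1) ≤ bid (C.card - 1 + k)} else ∅)
        (fun C => bid (C.card - 1 + k))
        (fun C => {x | bidStoch F x (belief γ C.card k) ≤ bid (C.card - 1 + k)})
        (fun C => ?_) (fun C => ?_) (fun C hC => ?_) (fun ω h₁ h₂ h₃ => ?_)
      · split_ifs with h
        · exact hmeas (by omega) hk _
        · exact MeasurableSet.empty
      · split_ifs with h
        · exact hmeas (by omega) le_rfl _
        · exact MeasurableSet.empty
      · rw [if_pos hC, if_pos hC]
        -- Both groups of rivals bid at least b^e(·, P^{|C|,k}), so beating them implies beating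
        -- opponents who follow that bid function.
        refine ⟨fun x hx => ?_, fun x hx => ?_,
          (isBidderLaw_belief hA0 hC hk).deviation_le hμ v _⟩
        · exact (bidStoch_le_bidStoch_self hμ hA0 hC hk x).trans hx
        · exact (bidStoch_le_bidStoch_one hμ hA0 hC hk x).trans hx
      · rw [if_pos h₂, if_pos h₂]
        exact ofReal_utility_direct_le hμ hA0 h₂ h₁.1 h₁.2.1 (fun c _ => h₃ c) bid h₁.2.2 rfl
    | join r =>
      have hk2 : 2 ≤ k := hs v k (by rw [hact]; trivial)
      have hms : MeasurableSet {x | F x ≤ F r} :=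
        measurableSet_le (monotone_cdf μ).measurable measurable_const
      refine hupper _ (fun _ => {x | F x ≤ F r}) (fun _ => {x | F x ≤ F r})
        (fun C => bidStoch F r (belief γ C.card k)) (fun _ => {x | F x ≤ F r})
        (fun _ => hms) (fun _ => hms) (fun C hC => ⟨subset_rfl, subset_rfl, ?_⟩)
        (fun ω h₁ h₂ h₃ => ?_)
      · rw [measureReal_cdf_le]
        exact (isBidderLaw_belief hA0 hC hk).payoff_le hμ v r
      · rw [← clubStrategy_of_two_le (F := F) (γ := γ) hk2 r]
        exact ofReal_utility_report_le hμ hA0 h₂ h₁.2.1 (fun c _ => h₃ c) r h₁.2.2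
  refine expectation_le_of_lintegral_le ?_ ?_
  · simp only [ProbabilityTheory.cond, lintegral_smul_measure]
    -- Conditioning only multiplies both sides by the same constant.
    exact mul_le_mul_right key _
  · refine Measure.ae_smul_measure ?_ (prior βC βA μ (selected i k))⁻¹
    filter_upwards [hgood] with ω ⟨h₁, h₂, h₃⟩
    exact utility_truthful_nonneg hμ hA0 h₂ h₁.2.1 (fun c _ => h₃ c) hv h₁.2.2

end Equilibrium

end BiddingClubs

end

theorem mainTheorem1 {κ : ℕ} (βC : PMF (Finset ℕ)) (βA : PMF (Finset (Fin κ)))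
    (hC0 : (βC.map Finset.card) 0 = 0) (hC1 : (βC.map Finset.card) 1 = 0)
    (hA0 : (βA.map Finset.card) 0 = 0)
    (μ : MeasureTheory.Measure ℝ) [MeasureTheory.IsProbabilityMeasure μ]
    [MeasureTheory.NullSingletonClass μ] (hμ : μ (Set.Iio 0) = 0) :
    (∀ n k : ℕ, 2 ≤ n → 1 ≤ k →
      BiddingClubs.IsSymmetricEquilibrium μ (BiddingClubs.belief (βA.map Finset.card) n k)
        (fun v => BiddingClubs.bidStoch (ProbabilityTheory.cdf μ) v
          (BiddingClubs.belief (βA.map Finset.card) n k))) ∧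
    BiddingClubs.IsBayesNash βC βA μ
      (fun _ => BiddingClubs.clubStrategy (ProbabilityTheory.cdf μ) (βA.map Finset.card)) :=
  ⟨fun _ _ hn hk => (BiddingClubs.isBidderLaw_belief hA0 hn hk).isSymmetricEquilibrium hμ,
    BiddingClubs.isBayesNash_clubStrategy hC0 hC1 hA0 hμ⟩
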